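/- Let $Y=(0,a_1)\times(0,a_2)\times(0,a_3)$ with $a_j>0$, let $|Y|$ be its volume and $H=L^2(Y,\mathbb{R}^3)$. Let $U=H^1_{\rm per}(Y,\mathbb{R})$ be the space of functions in $L^2(Y)$ whose $Y$-periodic extension to $\mathbb{R}^3$ has a weak gradient in $L^2_{\rm loc}$, and let $W_0\subset H$ be the space of fields with zero mean over $Y$ whose $Y$-periodic extension has zero weak divergence in $\mathbb{R}^3$. Let $A\in L^\infty(Y,\mathbb{R}^{3\times3})$ be symmetric and uniformly positive definite a.e. in $Y$. Let $A^*\in\mathbb{R}^{3\times 3}$ be the symmetric matrix with $$(A^*\xi,\xi)=\inf_{u\in U}\frac1{|Y|}\int_Y (A(\xi+\nabla u),\xi+\nabla u)\,dx\quad\text{for all }\xi\in\mathbb{R}^3, \qquad (1)$$ and for $\alpha\in\mathbb{R}^3$ let $w_\alpha$ be the minimizer of $$\frac1{|Y|}\int_Y (A^{-1}(\alpha+w),\alpha+w)\,dx \quad\text{over } w\in W_0. \qquad (2)$$ Let $\lambda_1(A),\lambda_2(A)$ be the essential infimum and the essential supremum over $Y$ of the smallest and of the largest eigenvalue of $A(x)$,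 and $\lambda_1(A^*),\lambda_2(A^*)$ the smallest and the largest eigenvalue of $A^*$. Let $h>0$ and let $W_{0,h}\subset W_0$ be a finite-dimensional (discretization) subspace which has the first-order approximation property with constant $\kappa$ with respect to the exact dual minimizers, that is, $$\inf_{v\in W_{0,h}}\Vert w_\eta-v\Vert_H\le \kappa\,h\,\Vert\eta\Vert_2\quad\text{for all }\eta\in\mathbb{R}^3 .$$ Let $\xi\in\mathbb{R}^3$, $\Vert\xi\Vert_2=1$, let $u_\xi\in U$ be a minimizer in (1), and let $\widetilde u_\xi\in U$ satisfy $\Vert\nabla\widetilde u_\xi-\nabla u_\xi\Vert_H<\delta_1$ (which holds in particular if $\Vert\widetilde u_\xi-u_\xi\Vert_{H^1(Y)}<\delta_1$). Let $\widetilde A^*\in\mathbb{R}^{3\times3}$ satisfy $\Vert\widetilde A^*-A^*\Vert_2<\delta_2$ in the spectral norm. Put $\widetilde\alpha=\widetilde A^*\xi$ and $w_H=A(\xi+\nabla\widetilde u_\xi)-\widetilde A^*\xi$, and let $\widetilde w\in W_{0,h}$ be the $H$-orthogonal projection of $w_H$ onto $W_{0,h}$, i.e. $(\widetilde w,v)_H=(w_H,v)_H$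 for all $v\in W_{0,h}$. Then $$\Vert\widetilde w-w_{\widetilde\alpha}\Vert_H\le c_1\delta_1+c_2\delta_2+c\,h ,$$ where $c_1,c_2>0$ depend only on $|Y|$, $\lambda_1(A)$, $\lambda_2(A)$, $\lambda_1(A^*)$, $\lambda_2(A^*)$, and $c>0$ depends only on these numbers and on $\kappa$; in particular none of the constants depends on $h$, $\xi$, $\delta_1$, $\delta_2$, $\widetilde u_\xi$ or $\widetilde A^*$. -/

import Mathlib

open MeasureTheory
open scoped ContDiff InnerProductSpace

namespace PeriodicHom

/-- Euclidean space `ℝ³`. -/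
abbrev E3 : Type := EuclideanSpace ℝ (Fin 3)

/-- The open cuboid `Y = (0,a₁) × (0,a₂) × (0,a₃)`. -/
def cell (a : Fin 3 → ℝ) : Set E3 := {x | ∀ i, x i ∈ Set.Ioo 0 (a i)}

/-- Lebesgue measure on `Y`. -/
noncomputable abbrev cellMeasure (a : Fin 3 → ℝ) : Measure E3 := volume.restrict (cell a)

/-- The volume `|Y|`. -/
noncomputable def cellVol (a : Fin 3 → ℝ) : ℝ := volume.real (cell a)

/-- The scalar space `L²(Y, ℝ)`. -/
abbrev L2Scalar (a : Fin 3 → ℝ) : Type := Lp ℝ 2 (cellMeasure a)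

/-- The space `H = L²(Y, ℝ³)`. -/
abbrev H (a : Fin 3 → ℝ) : Type := Lp E3 2 (cellMeasure a)

/-- The `Y`-periodic extension of a function on `Y` to the whole space: the `i`-th coordinate is
reduced modulo `aᵢ` to `[0, aᵢ)`. Changing the function on a null subset of `Y` (or off `Y`)
changes the extension on a null set only. -/
noncomputable def perExt {F : Type*} (a : Fin 3 → ℝ) (f : E3 → F) : E3 → F :=
  fun x => f (WithLp.toLp 2 fun i => a i * Int.fract (x i / a i))

/-- `u ∈ U = H¹_per(Y, ℝ)` with `∇u = g`: both `u` and `g` are square integrable on `Y`, and on the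
whole space the periodic extension of `g` is the weak gradient of the periodic extension of `u`. -/
def IsPerGrad (a : Fin 3 → ℝ) (u : L2Scalar a) (g : H a) : Prop :=
  ∀ φ : E3 → ℝ, ContDiff ℝ ∞ φ → HasCompactSupport φ → ∀ v : E3,
    ∫ x, perExt a u x * fderiv ℝ φ x v = -∫ x, ⟪perExt a g x, v⟫_ℝ * φ x

/-- `w ∈ W₀`: the periodic extension of `w` has zero weak divergence on the whole space, and `w`
has zero mean over `Y`. Here `fderiv ℝ φ x (w x)` is `∇φ(x) ⬝ w(x)`. -/
def MemW0 (a : Fin 3 → ℝ) (w : H a) : Prop :=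
  (∀ φ : E3 → ℝ, ContDiff ℝ ∞ φ → HasCompactSupport φ →
    ∫ x, fderiv ℝ φ x (perExt a w x) = 0) ∧
  ∫ x in cell a, w x = 0

/-- The product of a `3 × 3` matrix and a vector of `ℝ³`. -/
noncomputable def mv (M : Matrix (Fin 3) (Fin 3) ℝ) (v : E3) : E3 :=
  Matrix.toEuclideanLin M v

/-- The coefficient `A`: measurable on `Y`, and for almost every `x ∈ Y` the matrix `A x` is
symmetric, with `A` uniformly positive definite and uniformly bounded. -/
structure IsCoefficient (a : Fin 3 → ℝ) (A : E3 → Matrix (Fin 3) (Fin 3) ℝ) : Prop where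
  aemeasurable : ∀ i j, AEMeasurable (fun x => A x i j) (cellMeasure a)
  symm : ∀ᵐ x ∂cellMeasure a, (A x).IsSymm
  bounds : ∃ m M : ℝ, 0 < m ∧ 0 < M ∧ ∀ᵐ x ∂cellMeasure a, ∀ v : E3,
    m * ⟪v, v⟫_ℝ ≤ ⟪mv (A x) v, v⟫_ℝ ∧ ⟪mv (A x) v, v⟫_ℝ ≤ M * ⟪v, v⟫_ℝ

/-- The averaged energy `|Y|⁻¹ ∫_Y (A (ξ + g), ξ + g) dx`. -/
noncomputable def energy (a : Fin 3 → ℝ) (A : E3 → Matrix (Fin 3) (Fin 3) ℝ) (ξ : E3) (g : H a) :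
    ℝ :=
  (cellVol a)⁻¹ * ∫ x in cell a, ⟪mv (A x) (ξ + g x), ξ + g x⟫_ℝ

/-- `u`, with gradient `g`, is a minimizer over `U` of the primal energy for `ξ`. -/
def IsPrimalMinimizer (a : Fin 3 → ℝ) (A : E3 → Matrix (Fin 3) (Fin 3) ℝ) (ξ : E3)
    (u : L2Scalar a) (g : H a) : Prop :=
  IsPerGrad a u g ∧
    ∀ (v : L2Scalar a) (k : H a), IsPerGrad a v k → energy a A ξ g ≤ energy a A ξ k

/-- `w` is a minimizer over `W₀` of the dual energy `|Y|⁻¹ ∫_Y (A⁻¹ (α + w), α + w) dx`. -/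
def IsDualMinimizer (a : Fin 3 → ℝ) (A : E3 → Matrix (Fin 3) (Fin 3) ℝ) (α : E3) (w : H a) :
    Prop :=
  MemW0 a w ∧
    ∀ v : H a, MemW0 a v → energy a (fun x => (A x)⁻¹) α w ≤ energy a (fun x => (A x)⁻¹) α v

/-- The infimum over `u ∈ U` of the averaged energy of `ξ + ∇u`. -/
noncomputable def homEnergy (a : Fin 3 → ℝ) (A : E3 → Matrix (Fin 3) (Fin 3) ℝ) (ξ : E3) : ℝ :=
  sInf {e : ℝ | ∃ (u : L2Scalar a) (g : H a), IsPerGrad a u g ∧ e = energy a A ξ g}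

/-- The homogenized matrix `A*`, that is, the symmetric matrix whose quadratic form is `homEnergy`.
Its entries are obtained by polarization; see `eq_homMatrix`. -/
noncomputable def homMatrix (a : Fin 3 → ℝ) (A : E3 → Matrix (Fin 3) (Fin 3) ℝ) :
    Matrix (Fin 3) (Fin 3) ℝ :=
  Matrix.of fun i j =>
    (homEnergy a A (EuclideanSpace.single i 1 + EuclideanSpace.single j 1)
      - homEnergy a A (EuclideanSpace.single i 1) - homEnergy a A (EuclideanSpace.single j 1)) / 2

/-- A symmetric matrix with quadratic form `homEnergy` is equal to `homMatrix`. -/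
theorem eq_homMatrix (a : Fin 3 → ℝ) (A : E3 → Matrix (Fin 3) (Fin 3) ℝ)
    (M : Matrix (Fin 3) (Fin 3) ℝ) (hM : M.IsSymm)
    (hq : ∀ ξ : E3, ⟪mv M ξ, ξ⟫_ℝ = homEnergy a A ξ) : M = homMatrix a A := by
  ext i j
  have hs : M j i = M i j := hM.apply i j
  have key : ∀ k l : Fin 3,
      ⟪mv M (EuclideanSpace.single k 1), (EuclideanSpace.single l 1 : E3)⟫_ℝ = M l k := by
    intro k l
    simp [mv, Matrix.toEuclideanLin, EuclideanSpace.inner_single_right, Matrix.toLpLin_apply]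
  have hadd : ∀ x y : E3, mv M (x + y) = mv M x + mv M y := fun x y => map_add _ x y
  simp only [homMatrix, Matrix.of_apply, ← hq, hadd, inner_add_left, inner_add_right, key]
  linarith

/-- The spectral norm `‖M‖₂` of a `3 × 3` matrix. -/
noncomputable def norm2 (M : Matrix (Fin 3) (Fin 3) ℝ) : ℝ :=
  ‖Matrix.toEuclideanCLM (n := Fin 3) (𝕜 := ℝ) M‖

/-- The smallest real eigenvalue. -/
noncomputable def minEig (M : Matrix (Fin 3) (Fin 3) ℝ) : ℝ := sInf (spectrum ℝ M)

/-- The largest real eigenvalue. -/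
noncomputable def maxEig (M : Matrix (Fin 3) (Fin 3) ℝ) : ℝ := sSup (spectrum ℝ M)

/-- The essential infimum over `Y` of the smallest eigenvalue of `A x`. -/
noncomputable def lam1 (a : Fin 3 → ℝ) (A : E3 → Matrix (Fin 3) (Fin 3) ℝ) : ℝ :=
  essInf (fun x => minEig (A x)) (cellMeasure a)

/-- The essential supremum over `Y` of the largest eigenvalue of `A x`. -/
noncomputable def lam2 (a : Fin 3 → ℝ) (A : E3 → Matrix (Fin 3) (Fin 3) ℝ) : ℝ :=
  essSup (fun x => maxEig (A x)) (cellMeasure a)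

/-- First-order approximation property, with constant `κ`, of a discretization space `Wh` with
discretization parameter `h`: each field `w_η`, `η ∈ ℝ³`, of exact dual minimizers is at distance
at most `κ h |η|` from `Wh` in `H`. -/
def HasApproxProperty (a : Fin 3 → ℝ) (A : E3 → Matrix (Fin 3) (Fin 3) ℝ)
    (Wh : Submodule ℝ (H a)) (h κ : ℝ) : Prop :=
  ∀ (η : E3) (w : H a), IsDualMinimizer a A η w →
    Metric.infDist w (Wh : Set (H a)) ≤ κ * h * ‖η‖

/-- The field `w_H = A (ξ + g) - Ã ξ`. -/
noncomputable def fieldH {a : Fin 3 → ℝ} (A : E3 → Matrix (Fin 3) (Fin 3) ℝ)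
    (At : Matrix (Fin 3) (Fin 3) ℝ) (ξ : E3) (g : H a) : E3 → E3 :=
  fun x => mv (A x) (ξ + g x) - mv At ξ

/-- `w` is the `H`-orthogonal projection onto `Wh` of the square integrable field `f`. -/
def IsProjection (a : Fin 3 → ℝ) (Wh : Submodule ℝ (H a)) (f : E3 → E3) (w : H a) : Prop :=
  w ∈ Wh ∧ ∀ v ∈ Wh, ⟪w, v⟫_ℝ = ∫ x in cell a, ⟪f x, v x⟫_ℝ

end PeriodicHom

open PeriodicHom

/-!
The flux `σ = A (ξ + ∇u_ξ)` of the exact primal minimizer already contains the exact dual minimizer: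
`w_α = σ - α` for `α = A* ξ`. Three facts give this. By the primal Euler–Lagrange equation `σ` is
orthogonal to all periodic gradients, hence weakly divergence free
(`exists_gradSpace_forall_inner_eq`, which periodizes the test functions). Its mean is `A* ξ`
(`integral_flux`): the energy infimum is the diagonal of a symmetric bilinear form, evaluated with
Lax–Milgram solutions in the closure of the gradients, and polarization recovers the mean flux.
Finally `A⁻¹ σ = ξ + ∇u_ξ` is orthogonal to `W₀`, which is the dual Euler–Lagrange equation
(`isDualMinimizer_flux`). The last point is the orthogonality of weak periodic gradients and weakly
solenoidal fields (`inner_grad_solenoidal`): it holds for smooth periodic potentials by testing with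
their product with a periodic partition of unity, and passes to the limit of mollifications because
the correlation `z ↦ ∫ ⟪∇u (x - z), w x⟫ dx` is continuous.

The error then splits as `w̃ - w_α̃ = (w̃ - w_α) + (w_α - w_α̃)`. The first term is bounded by
`‖w_H - w_α‖` plus twice the distance of `w_α` to `W_{0,h}` (`norm_sub_le_of_projection`), where
`w_H - w_α = A ∇(ũ - u_ξ) - (Ã - A*) ξ` and `|A* ξ| ≤ λ₂(A)` (`norm_homMatrix_le`). The second term
is controlled by the Lipschitz dependence of the dual minimizer on its constant field
(`norm_sub_le_of_dual`). Multiplication by `A` is treated throughout as a bounded symmetric coercive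
operator `mulOp` of `H`, and the dual energy is the quadratic form of a right inverse of it.
-/

/-! ### Quadratic forms of symmetric coercive operators -/

section QuadraticForms

variable {E : Type*} [NormedAddCommGroup E] [InnerProductSpace ℝ E]

theorem inner_map_add_self {T : E →ₗ[ℝ] E} (hs : T.IsSymmetric) (x y : E) :
    ⟪T (x + y), x + y⟫_ℝ = ⟪T x, x⟫_ℝ + 2 * ⟪T x, y⟫_ℝ + ⟪T y, y⟫_ℝ := by
  have h : ⟪T y, x⟫_ℝ = ⟪T x, y⟫_ℝ := by rw [hs y x, real_inner_comm]
  simp only [map_add, inner_add_left, inner_add_right, h]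
  ring

/-- For a symmetric `T` with `0 ≤ T ≤ M`, one has `T² ≤ M T`. -/
theorem norm_sq_map_le {T : E →ₗ[ℝ] E} (hs : T.IsSymmetric) {M : ℝ} (hM : 0 < M)
    (h0 : ∀ x, 0 ≤ ⟪T x, x⟫_ℝ) (hub : ∀ x, ⟪T x, x⟫_ℝ ≤ M * ⟪x, x⟫_ℝ) (x : E) :
    ‖T x‖ ^ 2 ≤ M * ⟪T x, x⟫_ℝ := by
  -- evaluate the form at `x - M⁻¹ T x`
  have h1 := h0 (x + (-M⁻¹) • T x)
  rw [inner_map_add_self hs, map_smul, inner_smul_left, inner_smul_right, inner_smul_right,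
    real_inner_self_eq_norm_sq] at h1
  have h2 := hub (T x)
  rw [real_inner_self_eq_norm_sq] at h2
  simp only [conj_trivial] at h1
  have h3 : M⁻¹ * M = 1 := inv_mul_cancel₀ hM.ne'
  have h4 : M⁻¹ * ⟪T (T x), T x⟫_ℝ ≤ ‖T x‖ ^ 2 := by
    calc _ ≤ M⁻¹ * (M * ‖T x‖ ^ 2) := by gcongr
      _ = _ := by rw [← mul_assoc, h3, one_mul]
  have h5 : 0 ≤ ⟪T x, x⟫_ℝ - M⁻¹ * ‖T x‖ ^ 2 := by
    have := mul_le_mul_of_nonneg_left h4 (inv_pos.2 hM).le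
    nlinarith
  have := mul_nonneg hM.le h5
  rw [mul_sub, ← mul_assoc, mul_inv_cancel₀ hM.ne'] at this
  linarith

theorem norm_map_le {T : E →ₗ[ℝ] E} (hs : T.IsSymmetric) {M : ℝ} (hM : 0 < M)
    (h0 : ∀ x, 0 ≤ ⟪T x, x⟫_ℝ) (hub : ∀ x, ⟪T x, x⟫_ℝ ≤ M * ⟪x, x⟫_ℝ) (x : E) :
    ‖T x‖ ≤ M * ‖x‖ := by
  have h1 := norm_sq_map_le hs hM h0 hub x
  have h2 := hub x
  rw [real_inner_self_eq_norm_sq] at h2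
  refine abs_le_of_sq_le_sq' ?_ (by positivity) |>.2
  nlinarith [mul_le_mul_of_nonneg_left h2 hM.le]

/-- The Euler–Lagrange equation of a quadratic minimization over an affine subspace. -/
theorem inner_map_eq_zero_of_isMin {T : E →ₗ[ℝ] E} (hs : T.IsSymmetric)
    (h0 : ∀ x, 0 ≤ ⟪T x, x⟫_ℝ) {V : Submodule ℝ E} {x₀ w : E} (hw : w ∈ V)
    (hmin : ∀ v ∈ V, ⟪T (x₀ + w), x₀ + w⟫_ℝ ≤ ⟪T (x₀ + v), x₀ + v⟫_ℝ) :
    ∀ v ∈ V, ⟪T (x₀ + w), v⟫_ℝ = 0 := by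
  intro v hv
  set b := ⟪T (x₀ + w), v⟫_ℝ with hb
  set c := ⟪T v, v⟫_ℝ with hc
  -- the step `-b / (c + 1)` along `v` changes the energy by `-b² (c + 2) / (c + 1)²`
  have hc0 : 0 ≤ c := h0 v
  have h1 := hmin (w + (-b / (c + 1)) • v) (V.add_mem hw (V.smul_mem _ hv))
  rw [← add_assoc, inner_map_add_self hs (x₀ + w), map_smul, inner_smul_left, inner_smul_right,
    inner_smul_right, ← hb, ← hc] at h1
  simp only [conj_trivial] at h1
  have h2 : 0 ≤ -(b ^ 2 * (c + 2)) / (c + 1) ^ 2 := by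
    have : -(b ^ 2 * (c + 2)) / (c + 1) ^ 2
        = 2 * (-b / (c + 1) * b) + -b / (c + 1) * (-b / (c + 1) * c) := by
      field_simp
      ring
    linarith
  by_contra hne
  have : 0 < b ^ 2 * (c + 2) / (c + 1) ^ 2 := by positivity
  rw [neg_div] at h2
  linarith

theorem isMin_of_inner_map_eq_zero {T : E →ₗ[ℝ] E} (hs : T.IsSymmetric)
    (h0 : ∀ x, 0 ≤ ⟪T x, x⟫_ℝ) {V : Submodule ℝ E} {x₀ w : E} (hw : w ∈ V)
    (hel : ∀ v ∈ V, ⟪T (x₀ + w), v⟫_ℝ = 0) :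
    ∀ v ∈ V, ⟪T (x₀ + w), x₀ + w⟫_ℝ ≤ ⟪T (x₀ + v), x₀ + v⟫_ℝ := by
  intro v hv
  have h1 := inner_map_add_self hs (x₀ + w) (v - w)
  rw [hel _ (V.sub_mem hv hw)] at h1
  have : x₀ + w + (v - w) = x₀ + v := by abel
  rw [this] at h1
  linarith [h0 (v - w)]

/-- Lax–Milgram on a closed subspace. -/
theorem exists_mem_forall_inner_map_eq [CompleteSpace E] (T : E →L[ℝ] E) {m : ℝ} (hm : 0 < m)
    (hlb : ∀ x, m * ⟪x, x⟫_ℝ ≤ ⟪T x, x⟫_ℝ) (V : Submodule ℝ E) (hV : IsClosed (V : Set E))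
    (f : E) : ∃ g ∈ V, ∀ k ∈ V, ⟪T g, k⟫_ℝ = ⟪f, k⟫_ℝ := by
  have : CompleteSpace V := hV.completeSpace_coe
  let B : V →L[ℝ] V →L[ℝ] ℝ :=
    (innerSL ℝ : V →L[ℝ] V →L[ℝ] ℝ).comp ((V.subtypeL.adjoint.comp T).comp V.subtypeL)
  have hB : ∀ x y : V, B x y = ⟪T x, (y : E)⟫_ℝ := fun x y => by
    simp [B, ContinuousLinearMap.adjoint_inner_left]
  have hco : IsCoercive B := ⟨m, hm, fun u => by
    have := hlb (u : E)
    rw [hB]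
    rwa [real_inner_self_eq_norm_sq, sq, ← mul_assoc] at this⟩
  refine ⟨hco.continuousLinearEquivOfBilin.symm (V.subtypeL.adjoint f), Subtype.coe_prop _, ?_⟩
  intro k hk
  have h1 := hco.continuousLinearEquivOfBilin_apply
    (hco.continuousLinearEquivOfBilin.symm (V.subtypeL.adjoint f)) ⟨k, hk⟩
  rw [ContinuousLinearEquiv.apply_symm_apply, hB, ContinuousLinearMap.adjoint_inner_left] at h1
  simpa using h1.symm

/-- The infimum of the energy over `x₀ + G` is its value at the solution of the Euler–Lagrange
equation in the closure of `G`. -/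
theorem isGLB_energy [CompleteSpace E] {T : E →L[ℝ] E} (hs : (T : E →ₗ[ℝ] E).IsSymmetric)
    (h0 : ∀ x, 0 ≤ ⟪T x, x⟫_ℝ) {G : Submodule ℝ E} {x₀ s : E} (hsG : s ∈ G.topologicalClosure)
    (hel : ∀ k ∈ G.topologicalClosure, ⟪T (x₀ + s), k⟫_ℝ = 0) :
    IsGLB ((fun g => ⟪T (x₀ + g), x₀ + g⟫_ℝ) '' (G : Set E)) ⟪T (x₀ + s), x₀ + s⟫_ℝ := by
  refine isGLB_of_mem_closure ?_ ?_
  · rintro _ ⟨g, hg, rfl⟩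
    exact isMin_of_inner_map_eq_zero (T := (T : E →ₗ[ℝ] E)) hs h0 hsG hel g
      (G.le_topologicalClosure hg)
  · have hc : Continuous fun g => ⟪T (x₀ + g), x₀ + g⟫_ℝ := by fun_prop
    exact image_closure_subset_closure_image hc ⟨s, hsG, rfl⟩

end QuadraticForms

section AbstractEstimate

variable {E : Type*} [NormedAddCommGroup E] [InnerProductSpace ℝ E]

/-- `M⁻¹ ≤ S` for a right inverse `S` of a symmetric operator `0 ≤ T ≤ M`. -/
theorem inner_rightInverse_self_ge {T S : E →ₗ[ℝ] E} (hs : T.IsSymmetric) {M : ℝ} (hM : 0 < M)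
    (h0 : ∀ x, 0 ≤ ⟪T x, x⟫_ℝ) (hub : ∀ x, ⟪T x, x⟫_ℝ ≤ M * ⟪x, x⟫_ℝ) (hTS : ∀ x, T (S x) = x)
    (x : E) : M⁻¹ * ‖x‖ ^ 2 ≤ ⟪S x, x⟫_ℝ := by
  have h := norm_sq_map_le hs hM h0 hub (S x)
  rw [hTS, real_inner_comm] at h
  rwa [inv_mul_le_iff₀ hM]

theorem norm_rightInverse_le {T S : E →ₗ[ℝ] E} {m : ℝ} (hm : 0 < m)
    (hlb : ∀ x, m * ⟪x, x⟫_ℝ ≤ ⟪T x, x⟫_ℝ) (hTS : ∀ x, T (S x) = x) (x : E) :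
    ‖S x‖ ≤ m⁻¹ * ‖x‖ := by
  have h := hlb (S x)
  rw [hTS, real_inner_self_eq_norm_sq] at h
  have h2 := h.trans (real_inner_le_norm x (S x))
  rw [le_inv_mul_iff₀ hm]
  rcases (norm_nonneg (S x)).eq_or_lt with h3 | h3
  · rw [← h3]; simp
  · nlinarith

/-- Solutions of the dual Euler–Lagrange equation depend Lipschitz continuously on the constant
field. -/
theorem norm_sub_le_of_dual {T S : E →ₗ[ℝ] E} (hs : T.IsSymmetric) {m M : ℝ} (hm : 0 < m)
    (hM : 0 < M) (hlb : ∀ x, m * ⟪x, x⟫_ℝ ≤ ⟪T x, x⟫_ℝ)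
    (hub : ∀ x, ⟪T x, x⟫_ℝ ≤ M * ⟪x, x⟫_ℝ) (hTS : ∀ x, T (S x) = x) {W : Submodule ℝ E}
    {x₁ x₂ w₁ w₂ : E} (hw₁ : w₁ ∈ W) (hw₂ : w₂ ∈ W)
    (h₁ : ∀ v ∈ W, ⟪S (x₁ + w₁), v⟫_ℝ = 0) (h₂ : ∀ v ∈ W, ⟪S (x₂ + w₂), v⟫_ℝ = 0) :
    ‖w₁ - w₂‖ ≤ M / m * ‖x₁ - x₂‖ := by
  have h0 : ∀ x, 0 ≤ ⟪T x, x⟫_ℝ := fun x =>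
    (mul_nonneg hm.le real_inner_self_nonneg).trans (hlb x)
  have hd := W.sub_mem hw₁ hw₂
  have e1 : ⟪S (w₁ - w₂), w₁ - w₂⟫_ℝ = -⟪S (x₁ - x₂), w₁ - w₂⟫_ℝ := by
    have a := h₁ _ hd
    have b := h₂ _ hd
    simp only [map_add, map_sub, inner_add_left, inner_sub_left] at a b ⊢
    linarith
  have e2 := inner_rightInverse_self_ge hs hM h0 hub hTS (w₁ - w₂)
  have e3 : -⟪S (x₁ - x₂), w₁ - w₂⟫_ℝ ≤ m⁻¹ * ‖x₁ - x₂‖ * ‖w₁ - w₂‖ := by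
    refine (neg_le_abs _).trans ((abs_real_inner_le_norm _ _).trans ?_)
    gcongr
    exact norm_rightInverse_le hm hlb hTS _
  rcases (norm_nonneg (w₁ - w₂)).eq_or_lt with h3 | h3
  · rw [← h3]; positivity
  · have h4 : M⁻¹ * ‖w₁ - w₂‖ ≤ m⁻¹ * ‖x₁ - x₂‖ := by
      refine le_of_mul_le_mul_right ?_ h3
      calc _ = M⁻¹ * ‖w₁ - w₂‖ ^ 2 := by ring
        _ ≤ _ := by linarith
    rw [inv_mul_le_iff₀ hM] at h4
    calc _ ≤ _ := h4
      _ = _ := by ring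

/-- Quasi-optimality of the orthogonal projection `p` of a perturbation `f` of `w`. -/
theorem norm_sub_le_of_projection {V : Submodule ℝ E} {p f : E} (hp : p ∈ V)
    (hpf : ∀ v ∈ V, ⟪p, v⟫_ℝ = ⟪f, v⟫_ℝ) (w : E) :
    ‖p - w‖ ≤ ‖f - w‖ + 2 * Metric.infDist w (V : Set E) := by
  have key : ∀ v ∈ V, ‖p - w‖ ≤ ‖f - w‖ + 2 * dist w v := by
    intro v hv
    have h1 : ‖p - v‖ ≤ ‖f - v‖ := by
      have h2 : ‖p - v‖ ^ 2 ≤ ‖f - v‖ * ‖p - v‖ := by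
        rw [← real_inner_self_eq_norm_sq]
        have h3 : ⟪p - v, p - v⟫_ℝ = ⟪f - v, p - v⟫_ℝ := by
          rw [inner_sub_left, inner_sub_left, hpf _ (V.sub_mem hp hv)]
        rw [h3]
        exact real_inner_le_norm _ _
      rcases (norm_nonneg (p - v)).eq_or_lt with h3 | h3
      · rw [← h3]; positivity
      · exact le_of_mul_le_mul_right (by rwa [sq] at h2) h3
    have h4 : ‖p - w‖ ≤ ‖p - v‖ + ‖v - w‖ := norm_sub_le_norm_sub_add_norm_sub _ _ _
    have h5 : ‖f - v‖ ≤ ‖f - w‖ + ‖w - v‖ := norm_sub_le_norm_sub_add_norm_sub _ _ _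
    rw [dist_eq_norm]
    rw [norm_sub_rev v w] at h4
    linarith
  have h6 : (‖p - w‖ - ‖f - w‖) / 2 ≤ Metric.infDist w (V : Set E) := by
    rw [Metric.le_infDist ⟨p, hp⟩]
    intro v hv
    linarith [key v hv]
  linarith

end AbstractEstimate

/-! ### Eigenvalue bounds -/

section Eigenvalues

theorem isSymmetric_toEuclideanLin {M : Matrix (Fin 3) (Fin 3) ℝ} (hM : M.IsSymm) :
    (Matrix.toEuclideanLin M).IsSymmetric :=
  Matrix.isSymmetric_toEuclideanLin_iff.2 (by
    rw [Matrix.IsHermitian, Matrix.conjTranspose_eq_transpose_of_trivial]; exact hM)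

theorem exists_eigenvector {M : Matrix (Fin 3) (Fin 3) ℝ} {μ : ℝ} (hμ : μ ∈ spectrum ℝ M) :
    ∃ v : E3, v ≠ 0 ∧ mv M v = μ • v := by
  rw [← Matrix.spectrum_toLpLin (𝕜 := ℝ) (A := M) 2,
    ← Module.End.hasEigenvalue_iff_mem_spectrum] at hμ
  obtain ⟨v, hv⟩ := hμ.exists_hasEigenvector
  exact ⟨v, hv.2, hv.apply_eq_smul⟩

theorem spectrum_subset_of_bounds {M : Matrix (Fin 3) (Fin 3) ℝ} {p q : ℝ}
    (h : ∀ v : E3, p * ⟪v, v⟫_ℝ ≤ ⟪mv M v, v⟫_ℝ ∧ ⟪mv M v, v⟫_ℝ ≤ q * ⟪v, v⟫_ℝ) :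
    ∀ μ ∈ spectrum ℝ M, p ≤ μ ∧ μ ≤ q := by
  intro μ hμ
  obtain ⟨v, hv, he⟩ := exists_eigenvector hμ
  have hpos : 0 < ⟪v, v⟫_ℝ := real_inner_self_pos.2 hv
  have h1 := h v
  rw [he, real_inner_smul_left] at h1
  exact ⟨le_of_mul_le_mul_right h1.1 hpos, le_of_mul_le_mul_right h1.2 hpos⟩

theorem iInf_rayleigh_mem_spectrum {M : Matrix (Fin 3) (Fin 3) ℝ} (hM : M.IsSymm) :
    (⨅ x : {x : E3 // x ≠ 0}, ⟪mv M x, x⟫_ℝ / ‖(x : E3)‖ ^ 2) ∈ spectrum ℝ M := by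
  have h := (isSymmetric_toEuclideanLin hM).hasEigenvalue_iInf_of_finiteDimensional
  rw [Module.End.hasEigenvalue_iff_mem_spectrum, Matrix.toEuclideanLin,
    Matrix.spectrum_toLpLin] at h
  exact h

theorem iSup_rayleigh_mem_spectrum {M : Matrix (Fin 3) (Fin 3) ℝ} (hM : M.IsSymm) :
    (⨆ x : {x : E3 // x ≠ 0}, ⟪mv M x, x⟫_ℝ / ‖(x : E3)‖ ^ 2) ∈ spectrum ℝ M := by
  have h := (isSymmetric_toEuclideanLin hM).hasEigenvalue_iSup_of_finiteDimensional
  rw [Module.End.hasEigenvalue_iff_mem_spectrum, Matrix.toEuclideanLin,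
    Matrix.spectrum_toLpLin] at h
  exact h

theorem rayleigh_bounds {M : Matrix (Fin 3) (Fin 3) ℝ} {p q : ℝ}
    (h : ∀ v : E3, p * ⟪v, v⟫_ℝ ≤ ⟪mv M v, v⟫_ℝ ∧ ⟪mv M v, v⟫_ℝ ≤ q * ⟪v, v⟫_ℝ)
    (x : {x : E3 // x ≠ 0}) :
    p ≤ ⟪mv M x, x⟫_ℝ / ‖(x : E3)‖ ^ 2 ∧ ⟪mv M x, x⟫_ℝ / ‖(x : E3)‖ ^ 2 ≤ q := by
  have hpos : 0 < ‖(x : E3)‖ ^ 2 := by have := norm_pos_iff.2 x.2; positivity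
  have h1 := h x
  rw [real_inner_self_eq_norm_sq] at h1
  exact ⟨(le_div_iff₀ hpos).2 h1.1, (div_le_iff₀ hpos).2 h1.2⟩

/-- A symmetric matrix lies between its extreme eigenvalues. -/
theorem minEig_maxEig_bounds {M : Matrix (Fin 3) (Fin 3) ℝ} (hM : M.IsSymm) {p q : ℝ}
    (h : ∀ v : E3, p * ⟪v, v⟫_ℝ ≤ ⟪mv M v, v⟫_ℝ ∧ ⟪mv M v, v⟫_ℝ ≤ q * ⟪v, v⟫_ℝ) (v : E3) :
    minEig M * ⟪v, v⟫_ℝ ≤ ⟪mv M v, v⟫_ℝ ∧ ⟪mv M v, v⟫_ℝ ≤ maxEig M * ⟪v, v⟫_ℝ := by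
  rcases eq_or_ne v 0 with rfl | hv
  · simp
  have hpos : 0 < ‖v‖ ^ 2 := by have := norm_pos_iff.2 hv; positivity
  have hs := spectrum_subset_of_bounds h
  have h1 : minEig M ≤ ⟪mv M v, v⟫_ℝ / ‖v‖ ^ 2 :=
    (csInf_le ⟨p, fun μ hμ => (hs μ hμ).1⟩ (iInf_rayleigh_mem_spectrum hM)).trans
      (ciInf_le ⟨p, by rintro _ ⟨x, rfl⟩; exact (rayleigh_bounds h x).1⟩
        (⟨v, hv⟩ : {x : E3 // x ≠ 0}))
  have h2 : ⟪mv M v, v⟫_ℝ / ‖v‖ ^ 2 ≤ maxEig M :=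
    (le_ciSup (f := fun x : {x : E3 // x ≠ 0} => ⟪mv M x, x⟫_ℝ / ‖(x : E3)‖ ^ 2)
        ⟨q, by rintro _ ⟨x, rfl⟩; exact (rayleigh_bounds h x).2⟩
        ⟨v, hv⟩).trans
      (le_csSup ⟨q, fun μ hμ => (hs μ hμ).2⟩ (iSup_rayleigh_mem_spectrum hM))
  rw [real_inner_self_eq_norm_sq]
  exact ⟨(le_div_iff₀ hpos).1 h1, (div_le_iff₀ hpos).1 h2⟩

theorem minEig_maxEig_mem {M : Matrix (Fin 3) (Fin 3) ℝ} (hM : M.IsSymm) {p q : ℝ}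
    (h : ∀ v : E3, p * ⟪v, v⟫_ℝ ≤ ⟪mv M v, v⟫_ℝ ∧ ⟪mv M v, v⟫_ℝ ≤ q * ⟪v, v⟫_ℝ) :
    p ≤ minEig M ∧ minEig M ≤ q ∧ p ≤ maxEig M ∧ maxEig M ≤ q := by
  have hs := spectrum_subset_of_bounds h
  have hne : (spectrum ℝ M).Nonempty := ⟨_, iInf_rayleigh_mem_spectrum hM⟩
  have hb : BddBelow (spectrum ℝ M) := ⟨p, fun μ hμ => (hs μ hμ).1⟩
  have ha : BddAbove (spectrum ℝ M) := ⟨q, fun μ hμ => (hs μ hμ).2⟩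
  obtain ⟨μ, hμ⟩ := hne
  exact ⟨le_csInf ⟨μ, hμ⟩ fun μ hμ => (hs μ hμ).1, (csInf_le hb hμ).trans (hs μ hμ).2,
    (hs μ hμ).1.trans (le_csSup ha hμ), csSup_le ⟨μ, hμ⟩ fun μ hμ => (hs μ hμ).2⟩

end Eigenvalues

/-! ### The cell and the coefficient -/

section Cell

variable {a : Fin 3 → ℝ}

theorem isBounded_cell (a : Fin 3 → ℝ) : Bornology.IsBounded (cell a) := by
  refine (Metric.isBounded_closedBall (x := (0 : E3)) (r := √(∑ i, a i ^ 2))).subset ?_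
  intro x hx
  rw [mem_closedBall_zero_iff, EuclideanSpace.norm_eq]
  refine Real.sqrt_le_sqrt (Finset.sum_le_sum fun i _ => ?_)
  rw [Real.norm_eq_abs, sq_abs]
  have := hx i
  exact pow_le_pow_left₀ this.1.le this.2.le 2

theorem isOpen_cell (a : Fin 3 → ℝ) : IsOpen (cell a) := by
  have : cell a = ⋂ i, (fun x : E3 => x i) ⁻¹' Set.Ioo 0 (a i) := by
    ext x; simp [cell]
  rw [this]
  exact isOpen_iInter_of_finite fun i => isOpen_Ioo.preimage (by fun_prop)

theorem measurableSet_cell (a : Fin 3 → ℝ) : MeasurableSet (cell a) := (isOpen_cell a).measurableSet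

instance isFiniteMeasure_cellMeasure (a : Fin 3 → ℝ) : IsFiniteMeasure (cellMeasure a) :=
  ⟨by rw [Measure.restrict_apply_univ]; exact (isBounded_cell a).measure_lt_top⟩

theorem cellVol_pos (ha : ∀ i, 0 < a i) : 0 < cellVol a := by
  refine ENNReal.toReal_pos ((isOpen_cell a).measure_pos volume
    ⟨WithLp.toLp 2 fun i => a i / 2, fun i => ?_⟩).ne' (isBounded_cell a).measure_lt_top.ne
  have := ha i
  exact ⟨by simpa using this, by simpa using this⟩

theorem ae_cellMeasure_neBot (ha : ∀ i, 0 < a i) : (ae (cellMeasure a)).NeBot := by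
  rw [ae_neBot]
  intro h
  have h1 := cellVol_pos ha
  rw [cellVol, measureReal_def, ← Measure.restrict_apply_univ] at h1
  simp [show volume.restrict (cell a) = 0 from h] at h1

/-- The essential eigenvalue bounds of a coefficient. -/
theorem PeriodicHom.IsCoefficient.lam_bounds {A : E3 → Matrix (Fin 3) (Fin 3) ℝ} (ha : ∀ i, 0 < a i)
    (hA : IsCoefficient a A) : 0 < lam1 a A ∧ 0 < lam2 a A ∧ ∀ᵐ x ∂cellMeasure a, ∀ v : E3,
      lam1 a A * ⟪v, v⟫_ℝ ≤ ⟪mv (A x) v, v⟫_ℝ ∧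
        ⟪mv (A x) v, v⟫_ℝ ≤ lam2 a A * ⟪v, v⟫_ℝ := by
  have := ae_cellMeasure_neBot ha
  obtain ⟨m, M, hm, hM, hb⟩ := hA.bounds
  have h1 : ∀ᵐ x ∂cellMeasure a, m ≤ minEig (A x) ∧ minEig (A x) ≤ M ∧ m ≤ maxEig (A x) ∧
      maxEig (A x) ≤ M := by
    filter_upwards [hb, hA.symm] with x hx hs using minEig_maxEig_mem hs hx
  have b1 : Filter.IsBoundedUnder (· ≥ ·) (ae (cellMeasure a)) fun x => minEig (A x) :=
    ⟨m, Filter.eventually_map.2 (h1.mono fun x hx => hx.1)⟩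
  have b2 : Filter.IsBoundedUnder (· ≤ ·) (ae (cellMeasure a)) fun x => minEig (A x) :=
    ⟨M, Filter.eventually_map.2 (h1.mono fun x hx => hx.2.1)⟩
  have b3 : Filter.IsBoundedUnder (· ≤ ·) (ae (cellMeasure a)) fun x => maxEig (A x) :=
    ⟨M, Filter.eventually_map.2 (h1.mono fun x hx => hx.2.2.2)⟩
  have l1 : m ≤ lam1 a A :=
    le_essInf_of_ae_le m (h1.mono fun x hx => hx.1) b2.isCoboundedUnder_ge
  have l2 : m ≤ lam2 a A := by
    have h2 : ∀ᵐ x ∂cellMeasure a, m ≤ lam2 a A := by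
      filter_upwards [ae_le_essSup b3, h1] with x hx hx1 using hx1.2.2.1.trans hx
    exact h2.exists.choose_spec
  refine ⟨hm.trans_le l1, hm.trans_le l2, ?_⟩
  filter_upwards [hb, hA.symm, ae_essInf_le b1, ae_le_essSup b3] with x hx hs e1 e2 v
  have h3 := minEig_maxEig_bounds hs hx v
  have h4 : 0 ≤ ⟪v, v⟫_ℝ := real_inner_self_nonneg
  exact ⟨(mul_le_mul_of_nonneg_right e1 h4).trans h3.1,
    h3.2.trans (mul_le_mul_of_nonneg_right e2 h4)⟩

end Cell

/-! ### Multiplication by the coefficient -/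

section Operators

variable {a : Fin 3 → ℝ} {A : E3 → Matrix (Fin 3) (Fin 3) ℝ}

/-- The embedding of `ℝ³` into `H` as constant fields. -/
noncomputable def constField (a : Fin 3 → ℝ) : E3 →L[ℝ] H a := Lp.constL 2 (cellMeasure a) ℝ

theorem coeFn_constField (η : E3) : constField a η =ᵐ[cellMeasure a] fun _ => η :=
  Lp.coeFn_const _ _ _

theorem integrable_coeFn {F : Type*} [NormedAddCommGroup F] (f : Lp F 2 (cellMeasure a)) :
    Integrable f (cellMeasure a) :=
  (Lp.memLp f).integrable (by norm_num)

theorem inner_constField (η : E3) (f : H a) :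
    ⟪constField a η, f⟫_ℝ = ⟪η, ∫ x in cell a, f x⟫_ℝ := by
  rw [L2.inner_def, ← integral_inner (integrable_coeFn f)]
  refine integral_congr_ae ?_
  filter_upwards [coeFn_constField (a := a) η] with x hx
  rw [hx]

theorem integral_constField (η : E3) : ∫ x in cell a, constField a η x = cellVol a • η := by
  rw [integral_congr_ae (coeFn_constField η)]
  simp [cellVol]

theorem norm_constField (η : E3) : ‖constField a η‖ = √(cellVol a) * ‖η‖ := by
  have h : ‖constField a η‖ ^ 2 = cellVol a * ‖η‖ ^ 2 := by
    rw [← real_inner_self_eq_norm_sq, inner_constField, integral_constField,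
      real_inner_smul_right, real_inner_self_eq_norm_sq]
  rw [← Real.sqrt_sq (norm_nonneg (constField a η)), h, Real.sqrt_mul (by
    exact measureReal_nonneg), Real.sqrt_sq (norm_nonneg _)]

theorem mv_apply (M : Matrix (Fin 3) (Fin 3) ℝ) (v : E3) (i : Fin 3) :
    mv M v i = ∑ j, M i j * v j := by
  simp [mv, Matrix.toLpLin_apply, Matrix.mulVec, dotProduct]

theorem mv_mul (M N : Matrix (Fin 3) (Fin 3) ℝ) (v : E3) : mv (M * N) v = mv M (mv N v) := by
  simp [mv, Matrix.toLpLin_apply, Matrix.mulVec_mulVec]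

theorem PeriodicHom.IsCoefficient.aestronglyMeasurable_mv (hA : IsCoefficient a A) {f : E3 → E3}
    (hf : AEStronglyMeasurable f (cellMeasure a)) :
    AEStronglyMeasurable (fun x => mv (A x) (f x)) (cellMeasure a) := by
  have h1 : AEMeasurable (fun x i => mv (A x) (f x) i) (cellMeasure a) := by
    refine aemeasurable_pi_lambda _ fun i => ?_
    simp only [mv_apply]
    refine Finset.aemeasurable_fun_sum _ fun j _ => (hA.aemeasurable i j).mul ?_
    exact (by fun_prop : Measurable fun v : E3 => v j).comp_aemeasurable hf.aemeasurable
  exact ((WithLp.measurable_toLp 2 _).comp_aemeasurable h1).aestronglyMeasurable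

theorem PeriodicHom.IsCoefficient.norm_mv_le (hA : IsCoefficient a A) :
    ∃ M : ℝ, ∀ᵐ x ∂cellMeasure a, ∀ v : E3, ‖mv (A x) v‖ ≤ M * ‖v‖ := by
  obtain ⟨m, M, hm, hM, hb⟩ := hA.bounds
  refine ⟨M, ?_⟩
  filter_upwards [hb, hA.symm] with x hx hs v
  exact norm_map_le (isSymmetric_toEuclideanLin hs) hM
    (fun v => (mul_nonneg hm.le real_inner_self_nonneg).trans (hx v).1) (fun v => (hx v).2) v

theorem PeriodicHom.IsCoefficient.memLp_mv (hA : IsCoefficient a A) (f : H a) :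
    MemLp (fun x => mv (A x) (f x)) 2 (cellMeasure a) := by
  obtain ⟨M, hM⟩ := hA.norm_mv_le
  exact MemLp.of_le_mul (Lp.memLp f) (hA.aestronglyMeasurable_mv (Lp.aestronglyMeasurable f))
    (hM.mono fun x hx => hx _)

/-- Multiplication by the coefficient `A` as a bounded operator of `H`. -/
noncomputable def mulOp (hA : IsCoefficient a A) : H a →L[ℝ] H a :=
  LinearMap.mkContinuousOfExistsBound
    { toFun := fun f => (hA.memLp_mv f).toLp _
      map_add' := fun f g => by
        ext1
        filter_upwards [(hA.memLp_mv (f + g)).coeFn_toLp, (hA.memLp_mv f).coeFn_toLp,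
          (hA.memLp_mv g).coeFn_toLp, Lp.coeFn_add f g,
          Lp.coeFn_add ((hA.memLp_mv f).toLp _) ((hA.memLp_mv g).toLp _)] with x h1 h2 h3 h4 h5
        rw [h1, h5, Pi.add_apply, h2, h3, h4, Pi.add_apply]
        exact map_add _ _ _
      map_smul' := fun c f => by
        ext1
        filter_upwards [(hA.memLp_mv (c • f)).coeFn_toLp, (hA.memLp_mv f).coeFn_toLp,
          Lp.coeFn_smul c f, Lp.coeFn_smul c ((hA.memLp_mv f).toLp _)] with x h1 h2 h3 h4
        rw [h1, RingHom.id_apply, h4, Pi.smul_apply, h2, h3, Pi.smul_apply]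
        exact map_smul _ _ _ }
    (by
      obtain ⟨M, hM⟩ := hA.norm_mv_le
      refine ⟨M, fun f => Lp.norm_le_mul_norm_of_ae_le_mul ?_⟩
      filter_upwards [hM, (hA.memLp_mv f).coeFn_toLp] with x hx h1
      change ‖((hA.memLp_mv f).toLp _ : H a) x‖ ≤ _
      rw [h1]
      exact hx _)

theorem coeFn_mulOp (hA : IsCoefficient a A) (f : H a) :
    mulOp hA f =ᵐ[cellMeasure a] fun x => mv (A x) (f x) :=
  (hA.memLp_mv f).coeFn_toLp

theorem inner_mulOp (hA : IsCoefficient a A) (f g : H a) :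
    ⟪mulOp hA f, g⟫_ℝ = ∫ x in cell a, ⟪mv (A x) (f x), g x⟫_ℝ := by
  rw [L2.inner_def]
  refine integral_congr_ae ?_
  filter_upwards [coeFn_mulOp hA f] with x hx
  rw [hx]

theorem isSymmetric_mulOp (hA : IsCoefficient a A) :
    (mulOp hA : H a →ₗ[ℝ] H a).IsSymmetric := by
  intro f g
  rw [real_inner_comm]
  change ⟪g, mulOp hA f⟫_ℝ = ⟪f, mulOp hA g⟫_ℝ
  rw [real_inner_comm, real_inner_comm (mulOp hA g), inner_mulOp, inner_mulOp]
  refine integral_congr_ae ?_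
  filter_upwards [hA.symm] with x hx
  change ⟪Matrix.toEuclideanLin (A x) (f x), g x⟫_ℝ = ⟪Matrix.toEuclideanLin (A x) (g x), f x⟫_ℝ
  rw [isSymmetric_toEuclideanLin hx, real_inner_comm]

theorem mulOp_bounds (hA : IsCoefficient a A) {m M : ℝ} (hb : ∀ᵐ x ∂cellMeasure a, ∀ v : E3,
    m * ⟪v, v⟫_ℝ ≤ ⟪mv (A x) v, v⟫_ℝ ∧ ⟪mv (A x) v, v⟫_ℝ ≤ M * ⟪v, v⟫_ℝ) (f : H a) :
    m * ⟪f, f⟫_ℝ ≤ ⟪mulOp hA f, f⟫_ℝ ∧ ⟪mulOp hA f, f⟫_ℝ ≤ M * ⟪f, f⟫_ℝ := by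
  have hi : Integrable (fun x => ⟪mv (A x) (f x), f x⟫_ℝ) (cellMeasure a) := by
    refine (L2.integrable_inner (𝕜 := ℝ) (mulOp hA f) f).congr ?_
    filter_upwards [coeFn_mulOp hA f] with x hx
    rw [hx]
  have hi2 : Integrable (fun x => ⟪f x, f x⟫_ℝ) (cellMeasure a) := L2.integrable_inner f f
  rw [inner_mulOp, L2.inner_def, ← integral_const_mul, ← integral_const_mul]
  exact ⟨integral_mono_ae (hi2.const_mul _) hi (hb.mono fun x hx => (hx _).1),
    integral_mono_ae hi (hi2.const_mul _) (hb.mono fun x hx => (hx _).2)⟩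

theorem energy_eq (hA : IsCoefficient a A) (ξ : E3) (g : H a) :
    energy a A ξ g
      = (cellVol a)⁻¹ * ⟪mulOp hA (constField a ξ + g), constField a ξ + g⟫_ℝ := by
  rw [energy, inner_mulOp]
  congr 1
  refine integral_congr_ae ?_
  filter_upwards [coeFn_constField (a := a) ξ, Lp.coeFn_add (constField a ξ) g] with x h1 h2
  rw [h2, Pi.add_apply, h1]

/-- The operator `mulOp` has a right inverse. -/
theorem exists_rightInverse (hA : IsCoefficient a A) :
    ∃ S : H a →ₗ[ℝ] H a, ∀ f, mulOp hA (S f) = f := by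
  obtain ⟨m, M, hm, hM, hb⟩ := hA.bounds
  have hsurj : Function.Surjective (mulOp hA : H a →ₗ[ℝ] H a) := by
    intro f
    obtain ⟨g, -, hg⟩ := exists_mem_forall_inner_map_eq (mulOp hA) hm
      (fun f => (mulOp_bounds hA hb f).1) ⊤ isClosed_univ f
    exact ⟨g, ext_inner_right ℝ fun k => hg k trivial⟩
  obtain ⟨S, hS⟩ := (mulOp hA : H a →ₗ[ℝ] H a).exists_rightInverse_of_surjective
    (LinearMap.range_eq_top.2 hsurj)
  exact ⟨S, fun f => LinearMap.congr_fun hS f⟩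

theorem energy_inv_eq (hA : IsCoefficient a A) {S : H a →ₗ[ℝ] H a}
    (hS : ∀ f, mulOp hA (S f) = f) (α : E3) (w : H a) :
    energy a (fun x => (A x)⁻¹) α w
      = (cellVol a)⁻¹ * ⟪S (constField a α + w), constField a α + w⟫_ℝ := by
  obtain ⟨m, M, hm, hM, hb⟩ := hA.bounds
  rw [energy, L2.inner_def]
  congr 1
  refine integral_congr_ae ?_
  have h3 := coeFn_mulOp hA (S (constField a α + w))
  rw [hS] at h3
  filter_upwards [coeFn_constField (a := a) α, Lp.coeFn_add (constField a α) w, h3, hb]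
    with x h1 h2 h3 h4
  rw [h2, Pi.add_apply, h1] at h3 ⊢
  -- coercivity makes `A x` invertible, so that `(A x)⁻¹` is the genuine inverse
  have hu : IsUnit (A x).det := by
    rw [isUnit_iff_ne_zero]
    intro hdet
    obtain ⟨v, hv, hv0⟩ := Matrix.exists_mulVec_eq_zero_iff.2 hdet
    have h5 : mv (A x) (WithLp.toLp 2 v) = 0 := by
      simp [mv, Matrix.toLpLin_apply, hv0]
    have h6 := (h4 (WithLp.toLp 2 v)).1
    rw [h5, inner_zero_left, real_inner_self_eq_norm_sq] at h6
    have h7 : 0 < ‖(WithLp.toLp 2 v : E3)‖ := norm_pos_iff.2 (by simpa using hv)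
    have : 0 < m * ‖(WithLp.toLp 2 v : E3)‖ ^ 2 := by positivity
    linarith
  congr 1
  conv_lhs => rw [h3]
  rw [← mv_mul, Matrix.nonsing_inv_mul _ hu]
  simp [mv]

end Operators

/-! ### Periodic extension and the period lattice -/

section Lattice

variable {a : Fin 3 → ℝ}

/-- The basis `aᵢ eᵢ` of the period lattice. -/
noncomputable def latticeBasis (ha : ∀ i, 0 < a i) : Module.Basis (Fin 3) ℝ E3 :=
  (EuclideanSpace.basisFun (Fin 3) ℝ).toBasis.isUnitSMul fun i => (ha i).ne'.isUnit

theorem latticeBasis_repr (ha : ∀ i, 0 < a i) (x : E3) (i : Fin 3) :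
    (latticeBasis ha).repr x i = x i / a i := by
  rw [latticeBasis, Module.Basis.repr_isUnitSMul, Units.smul_def, Units.val_inv_eq_inv_val]
  simp [div_eq_inv_mul]

/-- The period lattice, spanned by the vectors `aᵢ eᵢ`. -/
noncomputable abbrev periodLattice (ha : ∀ i, 0 < a i) : Submodule ℤ E3 :=
  Submodule.span ℤ (Set.range (latticeBasis ha))

theorem perExt_eq (ha : ∀ i, 0 < a i) {F : Type*} (f : E3 → F) (x : E3) :
    perExt a f x = f (ZSpan.fract (latticeBasis ha) x) := by
  rw [perExt]
  congr 1
  apply (latticeBasis ha).repr.injective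
  ext i
  rw [ZSpan.repr_fract_apply, latticeBasis_repr, latticeBasis_repr]
  exact mul_div_cancel_left₀ _ (ha i).ne'

theorem perExt_vadd (ha : ∀ i, 0 < a i) {F : Type*} (f : E3 → F) (v : periodLattice ha) (x : E3) :
    perExt a f (v +ᵥ x) = perExt a f x := by
  rw [perExt_eq ha, perExt_eq ha, Submodule.vadd_def, vadd_eq_add, ZSpan.fract_zSpan_add _ _ v.2]

theorem perExt_of_mem (ha : ∀ i, 0 < a i) {F : Type*} (f : E3 → F) {x : E3}
    (hx : x ∈ ZSpan.fundamentalDomain (latticeBasis ha)) : perExt a f x = f x := by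
  rw [perExt_eq ha, ZSpan.fract_eq_self.2 hx]

theorem perExt_of_periodic (ha : ∀ i, 0 < a i) {F : Type*} {f : E3 → F}
    (hf : ∀ (v : periodLattice ha) x, f (v +ᵥ x) = f x) : perExt a f = f := by
  ext x
  rw [perExt_eq ha, ZSpan.fract_apply, sub_eq_neg_add]
  exact hf (-ZSpan.floor (latticeBasis ha) x) x

theorem cell_subset_fundamentalDomain (ha : ∀ i, 0 < a i) :
    cell a ⊆ ZSpan.fundamentalDomain (latticeBasis ha) := by
  intro x hx
  rw [ZSpan.mem_fundamentalDomain]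
  intro i
  rw [latticeBasis_repr]
  have := hx i
  exact ⟨(div_pos this.1 (ha i)).le, (div_lt_one (ha i)).2 this.2⟩

theorem ae_coord_ne_zero (i : Fin 3) : ∀ᵐ x : E3, x i ≠ 0 := by
  have h := Measure.addHaar_submodule (volume : Measure E3)
    (LinearMap.ker (EuclideanSpace.proj i : E3 →L[ℝ] ℝ).toLinearMap) (by
      intro h
      have : EuclideanSpace.single i (1 : ℝ) ∈
        LinearMap.ker (EuclideanSpace.proj i : E3 →L[ℝ] ℝ).toLinearMap := h ▸ trivial
      simp at this)
  rw [ae_iff]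
  convert h using 2
  ext x
  simp

theorem fundamentalDomain_ae_eq_cell (ha : ∀ i, 0 < a i) :
    ZSpan.fundamentalDomain (latticeBasis ha) =ᵐ[volume] cell a := by
  filter_upwards [ae_all_iff.2 ae_coord_ne_zero] with x hx
  refine propext ⟨fun h i => ?_, fun h => cell_subset_fundamentalDomain ha h⟩
  have h1 := (ZSpan.mem_fundamentalDomain _).1 h i
  rw [latticeBasis_repr] at h1
  have h2 : 0 ≤ x i := by simpa using (le_div_iff₀ (ha i)).1 h1.1
  exact ⟨h2.lt_of_ne (hx i).symm, (div_lt_one (ha i)).1 h1.2⟩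

theorem restrict_fundamentalDomain (ha : ∀ i, 0 < a i) :
    volume.restrict (ZSpan.fundamentalDomain (latticeBasis ha)) = cellMeasure a :=
  Measure.restrict_congr_set (fundamentalDomain_ae_eq_cell ha)

theorem isAddFundamentalDomain_periodLattice (ha : ∀ i, 0 < a i) :
    IsAddFundamentalDomain (periodLattice ha) (ZSpan.fundamentalDomain (latticeBasis ha))
      (volume : Measure E3) :=
  ZSpan.isAddFundamentalDomain _ _

theorem measurableSet_fundamentalDomain (ha : ∀ i, 0 < a i) :
    MeasurableSet (ZSpan.fundamentalDomain (latticeBasis ha)) :=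
  ZSpan.fundamentalDomain_measurableSet _

instance vaddInvariantMeasure_periodLattice (ha : ∀ i, 0 < a i) :
    VAddInvariantMeasure (periodLattice ha) E3 volume :=
  ⟨fun c s _ => measure_preimage_add volume (c : E3) s⟩

instance measurableConstVAdd_periodLattice (ha : ∀ i, 0 < a i) :
    MeasurableConstVAdd (periodLattice ha) E3 :=
  ⟨fun c => measurable_const_add (c : E3)⟩

/-- The extension is well defined on almost everywhere classes. -/
theorem perExt_ae_eq (ha : ∀ i, 0 < a i) {F : Type*} {f g : E3 → F}
    (h : f =ᵐ[cellMeasure a] g) : perExt a f =ᵐ[volume] perExt a g := by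
  refine (isAddFundamentalDomain_periodLattice ha).measure_zero_of_invariant _ ?_ ?_
  · intro v
    ext x
    rw [Set.mem_vadd_set_iff_neg_vadd_mem]
    simp only [Set.mem_compl_iff, Set.mem_ofPred_eq, perExt_vadd ha]
  · rw [← Measure.restrict_apply₀' (measurableSet_fundamentalDomain ha).nullMeasurableSet]
    have h1 : ∀ᵐ x ∂volume.restrict (ZSpan.fundamentalDomain (latticeBasis ha)),
        perExt a f x = perExt a g x := by
      filter_upwards [ae_restrict_mem (measurableSet_fundamentalDomain ha),
        (restrict_fundamentalDomain ha).symm ▸ h] with x hx hfg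
      rw [perExt_of_mem ha _ hx, perExt_of_mem ha _ hx, hfg]
    exact h1

theorem aestronglyMeasurable_perExt (ha : ∀ i, 0 < a i) {F : Type*} [TopologicalSpace F]
    {f : E3 → F} (hf : AEStronglyMeasurable f (cellMeasure a)) :
    AEStronglyMeasurable (perExt a f) volume := by
  obtain ⟨g, hg, hfg⟩ := hf
  refine ⟨perExt a g, hg.comp_measurable ?_, perExt_ae_eq ha hfg⟩
  refine (WithLp.measurable_toLp 2 _).comp (measurable_pi_lambda _ fun i => ?_)
  exact (measurable_fract.comp (Measurable.div_const (by fun_prop) _)).const_mul _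

theorem finite_vadd_mem (ha : ∀ i, 0 < a i) {B K : Set E3} (hB : Bornology.IsBounded B)
    (hK : Bornology.IsBounded K) : {v : periodLattice ha | ∃ x ∈ B, v +ᵥ x ∈ K}.Finite := by
  have h := ZSpan.setFinite_inter (latticeBasis ha) (hK.sub hB)
  refine (h.preimage (f := ((↑) : periodLattice ha → E3)) Subtype.coe_injective.injOn).subset ?_
  rintro v ⟨x, hx, hv⟩
  refine ⟨⟨_, hv, x, hx, ?_⟩, v.2⟩
  change (v : E3) + x - x = v
  abel

open scoped Pointwise in
theorem integrableOn_perExt (ha : ∀ i, 0 < a i) {F : Type*} [NormedAddCommGroup F]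
    {f : E3 → F} (hf : Integrable f (cellMeasure a)) {B : Set E3} (hB : Bornology.IsBounded B) :
    IntegrableOn (perExt a f) B := by
  set D := ZSpan.fundamentalDomain (latticeBasis ha)
  have hD : IntegrableOn (perExt a f) D := by
    have h1 : IntegrableOn f D := by rw [IntegrableOn, restrict_fundamentalDomain]; exact hf
    exact h1.congr_fun (fun x hx => (perExt_of_mem ha f hx).symm)
      (measurableSet_fundamentalDomain ha)
  have hfin := finite_vadd_mem ha (ZSpan.fundamentalDomain_isBounded (latticeBasis ha)) hB
  have hsub : B ⊆ ⋃ v ∈ {v : periodLattice ha | ∃ x ∈ D, v +ᵥ x ∈ B}, v +ᵥ D := by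
    intro x hx
    refine Set.mem_iUnion₂.2 ⟨ZSpan.floor (latticeBasis ha) x, ?_, ?_⟩
    · refine ⟨ZSpan.fract (latticeBasis ha) x, ZSpan.fract_mem_fundamentalDomain _ _, ?_⟩
      convert hx
      change (ZSpan.floor (latticeBasis ha) x : E3) + (x - _) = x
      abel
    · refine ⟨ZSpan.fract (latticeBasis ha) x, ZSpan.fract_mem_fundamentalDomain _ _, ?_⟩
      change (ZSpan.floor (latticeBasis ha) x : E3) + (x - _) = x
      abel
  refine IntegrableOn.mono_set ?_ hsub
  rw [integrableOn_finite_biUnion hfin]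
  intro v _
  exact ((isAddFundamentalDomain_periodLattice ha).integrableOn_iff
    ((isAddFundamentalDomain_periodLattice ha).vadd_of_comm v) (perExt_vadd ha f)).1 hD

theorem locallyIntegrable_perExt (ha : ∀ i, 0 < a i) {F : Type*} [NormedAddCommGroup F]
    {f : E3 → F} (hf : Integrable f (cellMeasure a)) : LocallyIntegrable (perExt a f) volume :=
  fun x => ⟨Metric.ball x 1, Metric.ball_mem_nhds x one_pos,
    integrableOn_perExt ha hf Metric.isBounded_ball⟩

theorem memLp_indicator_perExt (ha : ∀ i, 0 < a i) (f : H a) {B : Set E3}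
    (hB : Bornology.IsBounded B) (hm : MeasurableSet B) :
    MemLp (B.indicator (perExt a f)) 2 volume := by
  rw [memLp_indicator_iff_restrict hm,
    memLp_two_iff_integrable_sq_norm
      (aestronglyMeasurable_perExt ha (Lp.aestronglyMeasurable f)).restrict]
  exact integrableOn_perExt ha (f := fun x => ‖f x‖ ^ 2) (Lp.memLp f).integrable_norm_pow' hB

end Lattice

/-! ### Periodization of compactly supported functions -/

section Periodize

variable {a : Fin 3 → ℝ} (ha : ∀ i, 0 < a i) {F : Type*} [NormedAddCommGroup F]

/-- The sum of all translates of `K` by vectors of the period lattice. -/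
noncomputable def periodize (K : E3 → F) (x : E3) : F := ∑ᶠ v : periodLattice ha, K (v +ᵥ x)

theorem periodize_vadd (K : E3 → F) (v : periodLattice ha) (x : E3) :
    periodize ha K (v +ᵥ x) = periodize ha K x := by
  simpa [periodize, add_vadd] using
    finsum_comp_equiv (Equiv.addRight v) (f := fun w : periodLattice ha => K (w +ᵥ x))

theorem exists_finset_forall_eq_zero {K : E3 → F} (hK : HasCompactSupport K) {B : Set E3}
    (hB : Bornology.IsBounded B) :
    ∃ S : Finset (periodLattice ha), ∀ x ∈ B, ∀ v ∉ S, K (v +ᵥ x) = 0 := by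
  refine ⟨(finite_vadd_mem ha hB hK.isCompact.isBounded).toFinset, fun x hx v hv => ?_⟩
  by_contra h
  exact hv ((Set.Finite.mem_toFinset _).2 ⟨x, hx, subset_tsupport _ h⟩)

theorem periodize_eq_sum {K : E3 → F} {S : Finset (periodLattice ha)} {x : E3}
    (h : ∀ v ∉ S, K (v +ᵥ x) = 0) : periodize ha K x = ∑ v ∈ S, K (v +ᵥ x) :=
  finsum_eq_sum_of_support_subset _ fun v hv => by
    by_contra h1
    exact hv (h v h1)

theorem exists_eventuallyEq_sum {K : E3 → F} (hK : HasCompactSupport K) (x : E3) :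
    ∃ S : Finset (periodLattice ha), (∀ v ∉ S, K (v +ᵥ x) = 0) ∧
      periodize ha K =ᶠ[nhds x] fun y => ∑ v ∈ S, K ((v : E3) + y) := by
  obtain ⟨S, hS⟩ := exists_finset_forall_eq_zero ha hK (Metric.isBounded_ball (x := x) (r := 1))
  refine ⟨S, hS x (Metric.mem_ball_self one_pos), ?_⟩
  filter_upwards [Metric.ball_mem_nhds x one_pos] with y hy
  exact periodize_eq_sum ha (hS y hy)

variable [NormedSpace ℝ F]

theorem contDiff_periodize {K : E3 → F} (hK : HasCompactSupport K) (hc : ContDiff ℝ ∞ K) :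
    ContDiff ℝ ∞ (periodize ha K) := by
  rw [contDiff_iff_contDiffAt]
  intro x
  obtain ⟨S, -, hS⟩ := exists_eventuallyEq_sum ha hK x
  refine ContDiffAt.congr_of_eventuallyEq ?_ hS
  exact (ContDiff.sum fun v _ => hc.comp (by fun_prop)).contDiffAt

theorem fderiv_periodize {K : E3 → F} (hK : HasCompactSupport K) (hc : ContDiff ℝ ∞ K) (x : E3) :
    fderiv ℝ (periodize ha K) x = periodize ha (fderiv ℝ K) x := by
  classical
  have hd : Differentiable ℝ K := hc.differentiable (by simp)
  obtain ⟨T, hT0, hT⟩ : ∃ T : Finset (periodLattice ha),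
      (∀ v ∉ T, fderiv ℝ K (v +ᵥ x) = 0) ∧
      periodize ha K =ᶠ[nhds x] fun y => ∑ v ∈ T, K ((v : E3) + y) := by
    obtain ⟨S, hS⟩ := exists_finset_forall_eq_zero ha hK (Metric.isBounded_ball (x := x) (r := 1))
    obtain ⟨S', hS'⟩ := exists_finset_forall_eq_zero ha (hK.fderiv ℝ)
      (Metric.isBounded_ball (x := x) (r := 1))
    refine ⟨S ∪ S', fun v hv => hS' x (Metric.mem_ball_self one_pos) v
      fun h => hv (Finset.mem_union_right _ h), ?_⟩
    filter_upwards [Metric.ball_mem_nhds x one_pos] with y hy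
    exact periodize_eq_sum ha fun v hv => hS y hy v fun h => hv (Finset.mem_union_left _ h)
  rw [hT.fderiv_eq, periodize_eq_sum ha hT0, fderiv_fun_sum fun v _ => by fun_prop]
  exact Finset.sum_congr rfl fun v _ => fderiv_comp_add_left _

theorem periodize_mul_of_periodic (K Ψ : E3 → ℝ)
    (hΨ : ∀ (v : periodLattice ha) x, Ψ (v +ᵥ x) = Ψ x) (x : E3) :
    periodize ha (fun x => K x * Ψ x) x = periodize ha K x * Ψ x := by
  simp only [periodize, hΨ]
  exact (finsum_mul _ _).symm

/-- There is a smooth compactly supported function whose translates sum to one. -/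
theorem exists_periodize_eq_one :
    ∃ ψ : E3 → ℝ, ContDiff ℝ ∞ ψ ∧ HasCompactSupport ψ ∧ ∀ x, periodize ha ψ x = 1 := by
  -- normalize a bump function that equals one on a fundamental domain
  obtain ⟨r, hr⟩ := (ZSpan.fundamentalDomain_isBounded (latticeBasis ha)).subset_closedBall 0
  let θ : ContDiffBump (0 : E3) := ⟨max r 1, max r 1 + 1, by positivity, by linarith⟩
  have hθc : ContDiff ℝ ∞ θ := θ.contDiff
  have hθs : HasCompactSupport θ := θ.hasCompactSupport
  have hpos : ∀ x, 0 < periodize ha θ x := by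
    intro x
    obtain ⟨S, hS, -⟩ := exists_eventuallyEq_sum ha hθs x
    have h1 : θ (-ZSpan.floor (latticeBasis ha) x +ᵥ x) = 1 := by
      refine θ.one_of_mem_closedBall ?_
      have h2 := hr (ZSpan.fract_mem_fundamentalDomain (latticeBasis ha) x)
      rw [ZSpan.fract_apply, sub_eq_neg_add] at h2
      exact Metric.closedBall_subset_closedBall (le_max_left _ _) h2
    have h3 := single_le_finsum (-ZSpan.floor (latticeBasis ha) x)
      (f := fun v : periodLattice ha => θ (v +ᵥ x))
      (S.finite_toSet.subset fun v hv => by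
        by_contra h
        exact hv (hS v h)) fun v => θ.nonneg
    rw [h1] at h3
    exact one_pos.trans_le h3
  have hc := contDiff_periodize ha hθs hθc
  refine ⟨fun x => θ x * (periodize ha θ x)⁻¹, hθc.mul (hc.inv fun x => (hpos x).ne'),
    hθs.mul_right, fun x => ?_⟩
  rw [periodize_mul_of_periodic ha θ (fun x => (periodize ha θ x)⁻¹)
    fun v x => by rw [periodize_vadd]]
  exact mul_inv_cancel₀ (hpos x).ne'

theorem integrable_clm_perExt (ha : ∀ i, 0 < a i) {f : E3 → F} (hf : Integrable f (cellMeasure a))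
    {K : E3 → F →L[ℝ] ℝ} (hK : Continuous K) (hKs : HasCompactSupport K) :
    Integrable (fun x => K x (perExt a f x)) := by
  obtain ⟨C, hC⟩ := hKs.exists_bound_of_continuous hK
  have h1 : IntegrableOn (perExt a f) (tsupport K) :=
    integrableOn_perExt ha hf hKs.isCompact.isBounded
  have h2 : AEStronglyMeasurable (fun x => K x (perExt a f x)) volume :=
    isBoundedBilinearMap_apply.continuous.comp_aestronglyMeasurable
      (hK.aestronglyMeasurable.prodMk (aestronglyMeasurable_perExt ha hf.aestronglyMeasurable))
  refine (integrableOn_iff_integrable_of_support_subset (s := tsupport K) ?_).1 ?_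
  · intro x hx
    refine subset_tsupport _ fun h => hx ?_
    simp [h]
  · refine Integrable.mono' (h1.norm.const_mul C) h2.restrict (Filter.Eventually.of_forall ?_)
    intro x
    exact (K x).le_of_opNorm_le (hC x) _

/-- Unfolding: pairing a periodic extension with a compactly supported function is pairing on the
cell with its periodization. -/
theorem integral_clm_perExt {f : E3 → F} (hf : Integrable f (cellMeasure a))
    {K : E3 → F →L[ℝ] ℝ} (hK : Continuous K) (hKs : HasCompactSupport K) :
    ∫ x, K x (perExt a f x) = ∫ x in cell a, periodize ha K x (f x) := by
  have hi := integrable_clm_perExt ha hf hK hKs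
  have hr : volume.restrict (ZSpan.fundamentalDomain (latticeBasis ha))
    = volume.restrict (cell a) := restrict_fundamentalDomain ha
  obtain ⟨S, hS⟩ := exists_finset_forall_eq_zero ha hKs
    (ZSpan.fundamentalDomain_isBounded (latticeBasis ha))
  rw [(isAddFundamentalDomain_periodLattice ha).integral_eq_tsum'' _ hi,
    tsum_eq_sum (s := S), ← hr, ← integral_finsetSum]
  · refine setIntegral_congr_fun (measurableSet_fundamentalDomain ha) fun x hx => ?_
    simp only [periodize_eq_sum ha (hS x hx), sum_apply, perExt_vadd ha,
      perExt_of_mem ha f hx]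
  · intro v _
    exact ((measurePreserving_vadd v (volume : Measure E3)).integrable_comp_of_integrable
      hi).integrableOn
  · intro v hv
    refine setIntegral_eq_zero_of_forall_eq_zero fun x hx => ?_
    rw [hS x hx v hv]
    rfl

end Periodize

/-! ### Periodic gradients and solenoidal fields -/

section Spaces

variable {a : Fin 3 → ℝ}

theorem perExt_add_ae (ha : ∀ i, 0 < a i) {F : Type*} [NormedAddCommGroup F]
    (f g : Lp F 2 (cellMeasure a)) :
    ∀ᵐ x, perExt a (f + g : Lp F 2 (cellMeasure a)) x = perExt a f x + perExt a g x :=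
  perExt_ae_eq ha (Lp.coeFn_add f g)

theorem perExt_smul_ae (ha : ∀ i, 0 < a i) {F : Type*} [NormedAddCommGroup F] [NormedSpace ℝ F]
    (c : ℝ) (f : Lp F 2 (cellMeasure a)) :
    ∀ᵐ x, perExt a (c • f : Lp F 2 (cellMeasure a)) x = c • perExt a f x :=
  perExt_ae_eq ha (Lp.coeFn_smul c f)

theorem integrable_perExt_mul_fderiv (ha : ∀ i, 0 < a i) (u : L2Scalar a) {φ : E3 → ℝ}
    (hφ : ContDiff ℝ ∞ φ) (hs : HasCompactSupport φ) (v : E3) :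
    Integrable fun x => perExt a u x * fderiv ℝ φ x v := by
  have h1 : Continuous fun x => fderiv ℝ φ x v := by
    have := hφ.continuous_fderiv (by simp)
    fun_prop
  have h2 : HasCompactSupport fun x => fderiv ℝ φ x v := hs.fderiv_apply ℝ v
  refine (integrable_clm_perExt ha (integrable_coeFn u)
    (K := fun x => (fderiv ℝ φ x v) • ContinuousLinearMap.id ℝ ℝ) (by fun_prop)
    h2.smul_right).congr (.of_forall fun x => ?_)
  simp [mul_comm]

theorem integrable_inner_perExt_mul (ha : ∀ i, 0 < a i) (g : H a) {φ : E3 → ℝ}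
    (hφ : Continuous φ) (hs : HasCompactSupport φ) (v : E3) :
    Integrable fun x => ⟪perExt a g x, v⟫_ℝ * φ x := by
  refine (integrable_clm_perExt ha (integrable_coeFn g)
    (K := fun x => φ x • innerSL ℝ v) (by fun_prop) hs.smul_right).congr (.of_forall fun x => ?_)
  simp [mul_comm, real_inner_comm]

theorem integrable_fderiv_perExt (ha : ∀ i, 0 < a i) (w : H a) {φ : E3 → ℝ}
    (hφ : ContDiff ℝ ∞ φ) (hs : HasCompactSupport φ) :
    Integrable fun x => fderiv ℝ φ x (perExt a w x) :=
  integrable_clm_perExt ha (integrable_coeFn w) (hφ.continuous_fderiv (by simp)) (hs.fderiv ℝ)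

theorem isPerGrad_add (ha : ∀ i, 0 < a i) {u u' : L2Scalar a} {g g' : H a}
    (h : IsPerGrad a u g) (h' : IsPerGrad a u' g') : IsPerGrad a (u + u') (g + g') := by
  intro φ hφ hs v
  rw [integral_congr_ae (g := fun x => perExt a u x * fderiv ℝ φ x v
      + perExt a u' x * fderiv ℝ φ x v) (by
        filter_upwards [perExt_add_ae ha u u'] with x hx
        rw [hx, add_mul]),
    integral_congr_ae (f := fun x => ⟪perExt a (g + g' : H a) x, v⟫_ℝ * φ x)
      (g := fun x => ⟪perExt a g x, v⟫_ℝ * φ x + ⟪perExt a g' x, v⟫_ℝ * φ x) (by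
        filter_upwards [perExt_add_ae ha g g'] with x hx
        rw [hx, inner_add_left, add_mul]),
    integral_add (integrable_perExt_mul_fderiv ha u hφ hs v)
      (integrable_perExt_mul_fderiv ha u' hφ hs v),
    integral_add (integrable_inner_perExt_mul ha g hφ.continuous hs v)
      (integrable_inner_perExt_mul ha g' hφ.continuous hs v), h φ hφ hs v, h' φ hφ hs v]
  ring

theorem isPerGrad_smul (ha : ∀ i, 0 < a i) (c : ℝ) {u : L2Scalar a} {g : H a}
    (h : IsPerGrad a u g) : IsPerGrad a (c • u) (c • g) := by
  intro φ hφ hs v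
  rw [integral_congr_ae (g := fun x => c * (perExt a u x * fderiv ℝ φ x v)) (by
        filter_upwards [perExt_smul_ae ha c u] with x hx
        rw [hx, smul_eq_mul, mul_assoc]),
    integral_congr_ae (f := fun x => ⟪perExt a (c • g : H a) x, v⟫_ℝ * φ x)
      (g := fun x => c * (⟪perExt a g x, v⟫_ℝ * φ x)) (by
        filter_upwards [perExt_smul_ae ha c g] with x hx
        rw [hx, real_inner_smul_left, mul_assoc]),
    integral_const_mul, integral_const_mul, h φ hφ hs v]
  ring

/-- The space `∇U` of gradients of periodic functions. -/
noncomputable def gradSpace (ha : ∀ i, 0 < a i) : Submodule ℝ (H a) where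
  carrier := {g | ∃ u, IsPerGrad a u g}
  add_mem' := fun ⟨u, hu⟩ ⟨u', hu'⟩ => ⟨u + u', isPerGrad_add ha hu hu'⟩
  zero_mem' := by
    refine ⟨0, ?_⟩
    have h0 : ∀ {F : Type} [NormedAddCommGroup F],
        ∀ᵐ x, perExt a (0 : Lp F 2 (cellMeasure a)) x = 0 := fun {F} _ =>
      perExt_ae_eq ha (Lp.coeFn_zero F 2 (cellMeasure a))
    intro φ hφ hs v
    rw [integral_congr_ae (g := 0) (by
        filter_upwards [h0 (F := ℝ)] with x hx
        rw [hx, zero_mul, Pi.zero_apply]),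
      integral_congr_ae (f := fun x => ⟪perExt a (0 : H a) x, v⟫_ℝ * φ x) (g := 0) (by
        filter_upwards [h0 (F := E3)] with x hx
        rw [hx, inner_zero_left, zero_mul, Pi.zero_apply])]
    simp
  smul_mem' := fun c _ ⟨u, hu⟩ => ⟨c • u, isPerGrad_smul ha c hu⟩

/-- The space `W₀` of periodic solenoidal fields with zero mean. -/
noncomputable def solenoidalSpace (ha : ∀ i, 0 < a i) : Submodule ℝ (H a) where
  carrier := {w | MemW0 a w}
  add_mem' := by
    rintro w w' ⟨h1, h2⟩ ⟨h1', h2'⟩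
    refine ⟨fun φ hφ hs => ?_, ?_⟩
    · rw [integral_congr_ae (g := fun x => fderiv ℝ φ x (perExt a w x)
          + fderiv ℝ φ x (perExt a w' x)) (by
            filter_upwards [perExt_add_ae ha w w'] with x hx
            rw [hx, map_add]),
        integral_add (integrable_fderiv_perExt ha w hφ hs) (integrable_fderiv_perExt ha w' hφ hs),
        h1 φ hφ hs, h1' φ hφ hs, add_zero]
    · rw [integral_congr_ae (Lp.coeFn_add w w')]
      simp only [Pi.add_apply]
      rw [integral_add (integrable_coeFn w) (integrable_coeFn w'), h2, h2', add_zero]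
  zero_mem' := by
    refine ⟨fun φ hφ hs => ?_, ?_⟩
    · rw [integral_congr_ae (g := 0) (by
        filter_upwards [perExt_ae_eq ha (Lp.coeFn_zero E3 2 (cellMeasure a))] with x hx
        rw [hx]
        simp [perExt])]
      simp
    · rw [integral_congr_ae (Lp.coeFn_zero E3 2 (cellMeasure a))]
      simp
  smul_mem' := by
    rintro c w ⟨h1, h2⟩
    refine ⟨fun φ hφ hs => ?_, ?_⟩
    · rw [integral_congr_ae (g := fun x => c * fderiv ℝ φ x (perExt a w x)) (by
            filter_upwards [perExt_smul_ae ha c w] with x hx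
            rw [hx, map_smul, smul_eq_mul]),
        integral_const_mul, h1 φ hφ hs, mul_zero]
    · rw [integral_congr_ae (Lp.coeFn_smul c w)]
      simp only [Pi.smul_apply]
      rw [integral_smul, h2, smul_zero]

theorem memLp_cell_of_continuous {F : Type*} [NormedAddCommGroup F] {f : E3 → F}
    (hf : Continuous f) [SecondCountableTopologyEither E3 F] : MemLp f 2 (cellMeasure a) := by
  obtain ⟨C, hC⟩ := (isBounded_cell a).isCompact_closure.exists_bound_of_continuousOn
    hf.continuousOn
  refine MemLp.of_bound hf.aestronglyMeasurable C ?_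
  filter_upwards [ae_restrict_mem (measurableSet_cell a)] with x hx using hC x (subset_closure hx)

theorem continuous_gradient {Ψ : E3 → ℝ} (hΨ : ContDiff ℝ ∞ Ψ) : Continuous (gradient Ψ) :=
  (InnerProductSpace.toDual ℝ E3).symm.continuous.comp (hΨ.continuous_fderiv (by simp))

theorem inner_gradient {Ψ : E3 → ℝ} (x v : E3) : ⟪gradient Ψ x, v⟫_ℝ = fderiv ℝ Ψ x v :=
  InnerProductSpace.toDual_symm_apply

/-- A smooth periodic function belongs to `U`, with its classical gradient. -/
theorem isPerGrad_of_contDiff (ha : ∀ i, 0 < a i) {Ψ : E3 → ℝ} (hΨ : ContDiff ℝ ∞ Ψ)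
    (hp : ∀ (v : periodLattice ha) x, Ψ (v +ᵥ x) = Ψ x) :
    IsPerGrad a ((memLp_cell_of_continuous hΨ.continuous).toLp Ψ)
      ((memLp_cell_of_continuous (continuous_gradient hΨ)).toLp (gradient Ψ)) := by
  have hgp : ∀ (v : periodLattice ha) x, gradient Ψ (v +ᵥ x) = gradient Ψ x := by
    intro v x
    have h1 : fderiv ℝ (fun y => Ψ ((v : E3) + y)) x = fderiv ℝ Ψ ((v : E3) + x) :=
      fderiv_comp_add_left _
    have h2 : (fun y => Ψ ((v : E3) + y)) = Ψ := funext fun y => hp v y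
    rw [h2] at h1
    exact congrArg (InnerProductSpace.toDual ℝ E3).symm h1.symm
  have e1 := perExt_ae_eq ha (memLp_cell_of_continuous (a := a) hΨ.continuous).coeFn_toLp
  have e2 := perExt_ae_eq ha
    (memLp_cell_of_continuous (a := a) (continuous_gradient hΨ)).coeFn_toLp
  rw [perExt_of_periodic ha hp] at e1
  rw [perExt_of_periodic ha hgp] at e2
  intro φ hφ hs v
  rw [integral_congr_ae (g := fun x => Ψ x * fderiv ℝ φ x v) (by
      filter_upwards [e1] with x hx
      rw [hx]),
    integral_congr_ae (f := fun x => ⟪perExt a _ x, v⟫_ℝ * φ x)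
      (g := fun x => fderiv ℝ Ψ x v * φ x) (by
        filter_upwards [e2] with x hx
        rw [hx, inner_gradient])]
  have c1 : Continuous fun x => fderiv ℝ Ψ x v := by
    have := hΨ.continuous_fderiv (by simp)
    fun_prop
  have c2 : Continuous fun x => fderiv ℝ φ x v := by
    have := hφ.continuous_fderiv (by simp)
    fun_prop
  have c3 := hΨ.continuous
  have c4 := hφ.continuous
  exact integral_mul_fderiv_eq_neg_fderiv_mul_of_integrable
    ((c1.mul c4).integrable_of_hasCompactSupport hs.mul_left)
    ((c3.mul c2).integrable_of_hasCompactSupport (hs.fderiv_apply ℝ v).mul_left)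
    ((c3.mul c4).integrable_of_hasCompactSupport hs.mul_left)
    (fun x _ => hΨ.contDiffAt.differentiableAt (by simp))
    (fun x _ => hφ.contDiffAt.differentiableAt (by simp))

/-- The weak divergence of a field tested with `φ` is its inner product in `H` with the gradient of
the periodization of `φ`. -/
theorem exists_gradSpace_forall_inner_eq (ha : ∀ i, 0 < a i) {φ : E3 → ℝ} (hφ : ContDiff ℝ ∞ φ)
    (hs : HasCompactSupport φ) :
    ∃ g ∈ gradSpace ha, ∀ w : H a, ⟪g, w⟫_ℝ = ∫ x, fderiv ℝ φ x (perExt a w x) := by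
  have hc := contDiff_periodize ha hs hφ
  refine ⟨_, ⟨_, isPerGrad_of_contDiff ha hc (periodize_vadd ha φ)⟩, fun w => ?_⟩
  rw [integral_clm_perExt ha (integrable_coeFn w) (hφ.continuous_fderiv (by simp)) (hs.fderiv ℝ),
    L2.inner_def]
  refine integral_congr_ae ?_
  filter_upwards [(memLp_cell_of_continuous (a := a) (continuous_gradient hc)).coeFn_toLp]
    with x hx
  rw [hx, inner_gradient, fderiv_periodize ha hs hφ]

/-- A field orthogonal to all periodic gradients becomes an element of `W₀` once its mean is
subtracted. -/
theorem sub_constField_mem_solenoidalSpace (ha : ∀ i, 0 < a i) {p : H a}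
    (hp : ∀ k ∈ gradSpace ha, ⟪p, k⟫_ℝ = 0) {α : E3}
    (hα : ∫ x in cell a, p x = cellVol a • α) :
    p - constField a α ∈ solenoidalSpace ha := by
  refine ⟨fun φ hφ hs => ?_, ?_⟩
  · obtain ⟨g, hg, hgw⟩ := exists_gradSpace_forall_inner_eq ha hφ hs
    rw [← hgw, inner_sub_right, real_inner_comm, hp g hg, hgw, zero_sub, neg_eq_zero]
    rw [integral_congr_ae (g := fun x => 1 * fderiv ℝ φ x α) (by
      filter_upwards [perExt_ae_eq ha (coeFn_constField (a := a) α)] with x hx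
      rw [hx, one_mul]
      rfl)]
    have c2 : Continuous fun x => fderiv ℝ φ x α := by
      have := hφ.continuous_fderiv (by simp)
      fun_prop
    rw [integral_mul_fderiv_eq_neg_fderiv_mul_of_integrable (f := fun _ => (1 : ℝ))]
    · simp
    · simp
    · simpa using c2.integrable_of_hasCompactSupport (hs.fderiv_apply ℝ α)
    · simpa using hφ.continuous.integrable_of_hasCompactSupport hs
    · exact fun x _ => differentiableAt_const _
    · exact fun x _ => hφ.contDiffAt.differentiableAt (by simp)
  · rw [integral_congr_ae (Lp.coeFn_sub p (constField a α))]
    simp only [Pi.sub_apply]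
    rw [integral_sub (integrable_coeFn p) (integrable_coeFn _), hα, integral_constField, sub_self]

/-- Solenoidal fields are orthogonal to gradients of smooth periodic functions. -/
theorem setIntegral_fderiv_eq_zero (ha : ∀ i, 0 < a i) {w : H a} (hw : w ∈ solenoidalSpace ha)
    {Ψ : E3 → ℝ} (hΨ : ContDiff ℝ ∞ Ψ)
    (hp : ∀ (v : periodLattice ha) x, Ψ (v +ᵥ x) = Ψ x) :
    ∫ x in cell a, fderiv ℝ Ψ x (w x) = 0 := by
  obtain ⟨ψ, hψ, hψs, hψ1⟩ := exists_periodize_eq_one ha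
  have hφ : ContDiff ℝ ∞ fun x => ψ x * Ψ x := hψ.mul hΨ
  have hs : HasCompactSupport fun x => ψ x * Ψ x := hψs.mul_right
  have h1 := hw.1 _ hφ hs
  rw [integral_clm_perExt ha (integrable_coeFn w) (hφ.continuous_fderiv (by simp))
    (hs.fderiv ℝ)] at h1
  have h2 : periodize ha (fun x => ψ x * Ψ x) = Ψ := by
    ext x
    rw [periodize_mul_of_periodic ha ψ Ψ hp, hψ1, one_mul]
  rw [← h1]
  congr 1
  ext x
  rw [← fderiv_periodize ha hs hφ, h2]

end Spaces

/-! ### Orthogonality of gradients and solenoidal fields -/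

section Orthogonality

variable {a : Fin 3 → ℝ}

open scoped Convolution in
/-- Mollifying a function of `U` gives a smooth periodic function whose gradient is the mollified
weak gradient. -/
theorem exists_smooth_mollification (ha : ∀ i, 0 < a i) {u : L2Scalar a} {g : H a}
    (hu : IsPerGrad a u g) {ρ : E3 → ℝ} (hρ : ContDiff ℝ ∞ ρ) (hs : HasCompactSupport ρ) :
    ∃ Ψ : E3 → ℝ, ContDiff ℝ ∞ Ψ ∧ (∀ (v : periodLattice ha) x, Ψ (v +ᵥ x) = Ψ x) ∧
      ∀ x e, fderiv ℝ Ψ x e = ∫ z, ρ z * ⟪perExt a g (x - z), e⟫_ℝ := by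
  have hU := locallyIntegrable_perExt ha (integrable_coeFn u)
  refine ⟨perExt a u ⋆[ContinuousLinearMap.mul ℝ ℝ, volume] ρ,
    hs.contDiff_convolution_right _ hU hρ, fun v x => ?_, fun x e => ?_⟩
  · rw [convolution_def, convolution_def, ← integral_add_left_eq_self _ (v : E3)]
    refine integral_congr_ae (.of_forall fun t => ?_)
    have h1 : perExt a u ((v : E3) + t) = perExt a u t := perExt_vadd ha u v t
    have h2 : (v +ᵥ x : E3) - ((v : E3) + t) = x - t := by
      change (v : E3) + x - (v + t) = x - t
      abel
    simp only [h1, h2]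
  · have hd := hs.hasFDerivAt_convolution_right (ContinuousLinearMap.mul ℝ ℝ) hU
      (hρ.of_le (by simp)) x
    rw [hd.fderiv, convolution_precompR_apply _ hU (hs.fderiv ℝ)
      (hρ.continuous_fderiv (by simp))]
    have ht : ContDiff ℝ ∞ fun t => ρ (x - t) := hρ.comp (by fun_prop)
    have hts : HasCompactSupport fun t => ρ (x - t) := hs.comp_homeomorph (Homeomorph.subLeft x)
    have hft : ∀ t, fderiv ℝ (fun t => ρ (x - t)) t e = -fderiv ℝ ρ (x - t) e := by
      intro t
      have h1 := (hρ.differentiable (by simp) (x - t)).hasFDerivAt.comp t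
        ((hasFDerivAt_id t).const_sub x)
      rw [HasFDerivAt.fderiv (f := fun t => ρ (x - t)) h1]
      simp
    have h1 := hu _ ht hts e
    simp only [hft, mul_neg, integral_neg, neg_inj] at h1
    rw [convolution_def]
    simp only [ContinuousLinearMap.mul_apply']
    rw [h1, ← integral_sub_left_eq_self _ volume x]
    simp [mul_comm]

/-- The correlation `z ↦ ∫ ⟪f(x - z), g(x)⟫ dx` of square integrable fields is continuous. -/
theorem continuous_correlation {f g : E3 → E3} (hf : MemLp f 2 volume) (hg : MemLp g 2 volume) :
    Continuous fun z => ∫ x, ⟪f (x - z), g x⟫_ℝ := by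
  have h : ∀ z : E3, ∫ x, ⟪f (x - z), g x⟫_ℝ
      = ⟪DomAddAct.mk (-z) +ᵥ hf.toLp f, hg.toLp g⟫_ℝ := by
    intro z
    rw [L2.inner_def]
    refine integral_congr_ae ?_
    have hq : ∀ᵐ x, hf.toLp f (-z +ᵥ x) = f (-z +ᵥ x) :=
      (measurePreserving_vadd (-z) (volume : Measure E3)).quasiMeasurePreserving.ae
        hf.coeFn_toLp
    filter_upwards [DomAddAct.vadd_Lp_ae_eq (DomAddAct.mk (-z)) (hf.toLp f), hq, hg.coeFn_toLp]
      with x h1 h2 h3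
    rw [h1, h3]
    simp only [Equiv.symm_apply_apply]
    rw [h2, vadd_eq_add, sub_eq_neg_add]
  simp only [h]
  have : Fact ((2 : ENNReal) ≠ ⊤) := ⟨by norm_num⟩
  have : Continuous fun z : E3 => DomAddAct.mk (-z) +ᵥ hf.toLp f :=
    (DomAddAct.continuous_mk.comp continuous_neg).vadd continuous_const
  exact this.inner continuous_const

theorem integrable_correlation_integrand {f g : E3 → E3} (hf : MemLp f 2 volume)
    (hg : MemLp g 2 volume) {ρ : E3 → ℝ} (hρ : Continuous ρ) (hs : HasCompactSupport ρ) :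
    Integrable (fun p : E3 × E3 => ρ p.2 * ⟪f (p.1 - p.2), g p.1⟫_ℝ) (volume.prod volume) := by
  have hρi : Integrable ρ := hρ.integrable_of_hasCompactSupport hs
  have i1 : Integrable (fun p : E3 × E3 => ‖ρ p.2‖ * ‖f (p.1 - p.2)‖ ^ 2)
      (volume.prod volume) :=
    hρi.norm.convolution_integrand (ContinuousLinearMap.mul ℝ ℝ) (hf.integrable_norm_pow two_ne_zero)
  have i2 : Integrable (fun p : E3 × E3 => ‖g p.1‖ ^ 2 * ‖ρ p.2‖) (volume.prod volume) :=
    Integrable.mul_prod (hg.integrable_norm_pow two_ne_zero) hρi.norm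
  refine (i1.add i2).mono' ?_ (.of_forall fun p => ?_)
  · refine (hρ.aestronglyMeasurable.comp_snd).mul (AEStronglyMeasurable.inner ?_ ?_)
    · exact hf.aestronglyMeasurable.comp_quasiMeasurePreserving
        (quasiMeasurePreserving_sub volume volume)
    · exact hg.aestronglyMeasurable.comp_fst
  · have h1 := norm_inner_le_norm (𝕜 := ℝ) (f (p.1 - p.2)) (g p.1)
    rw [norm_mul, Pi.add_apply]
    have h2 := norm_nonneg (ρ p.2)
    have h3 : ‖⟪f (p.1 - p.2), g p.1⟫_ℝ‖ ≤ ‖f (p.1 - p.2)‖ ^ 2 + ‖g p.1‖ ^ 2 := by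
      nlinarith [sq_nonneg (‖f (p.1 - p.2)‖ - ‖g p.1‖), sq_nonneg (‖f (p.1 - p.2)‖ + ‖g p.1‖)]
    nlinarith [mul_le_mul_of_nonneg_left h3 h2]

open scoped Convolution in
/-- A continuous function annihilated by all mollifiers at the origin vanishes there. -/
theorem eq_zero_of_forall_bump {C : E3 → ℝ} (hC : Continuous C)
    (h : ∀ φ : ContDiffBump (0 : E3), φ.rOut ≤ 1 → ∫ z, φ.normed volume z * C z = 0) :
    C 0 = 0 := by
  by_contra hne
  have hpos : 0 < |C 0| / 2 := by have := abs_pos.2 hne; positivity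
  obtain ⟨δ, hδ, hδC⟩ := Metric.continuousAt_iff.1 hC.continuousAt (|C 0| / 2) hpos
  let φ : ContDiffBump (0 : E3) := ⟨min δ 1 / 2, min δ 1, by positivity, by
    have : 0 < min δ 1 := by positivity
    linarith⟩
  have h1 := φ.dist_normed_convolution_le (μ := volume) hC.aestronglyMeasurable (x₀ := 0)
    (ε := |C 0| / 2) fun x hx =>
      (hδC (lt_of_lt_of_le (Metric.mem_ball.1 hx) (min_le_left _ _))).le
  have h2 : (φ.normed volume ⋆[ContinuousLinearMap.lsmul ℝ ℝ, volume] C) 0 = 0 := by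
    rw [convolution_def, ← h φ (min_le_right _ _), ← integral_neg_eq_self]
    refine integral_congr_ae (.of_forall fun t => ?_)
    simp [φ.normed_neg]
  rw [h2, Real.dist_eq, zero_sub, abs_neg] at h1
  linarith

/-- Periodic gradients are orthogonal to solenoidal fields: the gradient is approximated by its
mollifications, and the correlation of the two fields carries the limit. -/
theorem inner_grad_solenoidal (ha : ∀ i, 0 < a i) {u : L2Scalar a} {g w : H a}
    (hu : IsPerGrad a u g) (hw : w ∈ solenoidalSpace ha) : ⟪g, w⟫_ℝ = 0 := by
  obtain ⟨R, hR⟩ := (isBounded_cell a).subset_closedBall 0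
  -- on the cell, translates of length at most one only see the extension on the ball `B`
  set B : Set E3 := Metric.closedBall 0 (R + 1)
  set f : E3 → E3 := B.indicator (perExt a g) with hf
  set k : E3 → E3 := (cell a).indicator w with hk
  have hfL : MemLp f 2 volume :=
    memLp_indicator_perExt ha g Metric.isBounded_closedBall measurableSet_closedBall
  have hkL : MemLp k 2 volume :=
    (memLp_indicator_iff_restrict (measurableSet_cell a)).2 (Lp.memLp w)
  have hfe : ∀ x ∈ cell a, ∀ z : E3, ‖z‖ ≤ 1 → f (x - z) = perExt a g (x - z) := by
    intro x hx z hz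
    refine Set.indicator_of_mem ?_ _
    have h1 := hR hx
    rw [mem_closedBall_zero_iff] at h1 ⊢
    exact (norm_sub_le _ _).trans (add_le_add h1 hz)
  have key := eq_zero_of_forall_bump (continuous_correlation hfL hkL) (fun φ hφ1 => by
    have hρ : ContDiff ℝ ∞ (φ.normed volume) := φ.contDiff_normed
    have hρs : HasCompactSupport (φ.normed volume) := φ.hasCompactSupport_normed
    obtain ⟨Ψ, hΨ, hΨp, hΨd⟩ := exists_smooth_mollification ha hu hρ hρs
    have h1 := setIntegral_fderiv_eq_zero ha hw hΨ hΨp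
    simp only [← integral_const_mul]
    rw [← integral_integral_swap
      (f := fun x z => φ.normed volume z * ⟪f (x - z), k x⟫_ℝ)
      (integrable_correlation_integrand hfL hkL hρ.continuous hρs), ← h1,
      ← integral_indicator (measurableSet_cell a)]
    refine integral_congr_ae (.of_forall fun x => ?_)
    by_cases hx : x ∈ cell a
    · simp only [Set.indicator_of_mem hx, hΨd, hk]
      refine integral_congr_ae (.of_forall fun z => ?_)
      by_cases hz : ‖z‖ ≤ 1
      · simp only [hfe x hx z hz]
      · have : φ.normed volume z = 0 := by
          rw [← Function.notMem_support, φ.support_normed_eq, mem_ball_zero_iff]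
          intro h
          exact hz (h.le.trans hφ1)
        simp only [this, zero_mul]
    · simp [hk, Set.indicator_of_notMem hx])
  rw [L2.inner_def, ← key, ← integral_indicator (measurableSet_cell a)]
  refine integral_congr_ae (.of_forall fun x => ?_)
  by_cases hx : x ∈ cell a
  · have h2 := hfe x hx 0 (by simp)
    rw [sub_zero, perExt_of_mem ha _ (cell_subset_fundamentalDomain ha hx)] at h2
    simp only [Set.indicator_of_mem hx, hk, sub_zero, h2]
  · simp [hk, Set.indicator_of_notMem hx]

end Orthogonality

/-! ### The homogenized matrix and the dual minimizers -/

section Homogenization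

variable {a : Fin 3 → ℝ} {A : E3 → Matrix (Fin 3) (Fin 3) ℝ}

theorem mulOp_nonneg (hA : IsCoefficient a A) (f : H a) : 0 ≤ ⟪mulOp hA f, f⟫_ℝ := by
  obtain ⟨m, M, hm, -, hb⟩ := hA.bounds
  exact (mul_nonneg hm.le real_inner_self_nonneg).trans (mulOp_bounds hA hb f).1

/-- The Euler–Lagrange equation of a primal minimizer. -/
theorem inner_flux_eq_zero (ha : ∀ i, 0 < a i) (hA : IsCoefficient a A) {ξ : E3} {u : L2Scalar a}
    {g : H a} (h : IsPrimalMinimizer a A ξ u g) :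
    ∀ k ∈ gradSpace ha, ⟪mulOp hA (constField a ξ + g), k⟫_ℝ = 0 := by
  refine inner_map_eq_zero_of_isMin (isSymmetric_mulOp hA) (mulOp_nonneg hA) ⟨u, h.1⟩ ?_
  rintro k ⟨v, hv⟩
  have h1 := h.2 v k hv
  rw [energy_eq hA, energy_eq hA] at h1
  exact le_of_mul_le_mul_left h1 (inv_pos.2 (cellVol_pos ha))

theorem isSymmetric_and_nonneg_rightInverse (hA : IsCoefficient a A) {S : H a →ₗ[ℝ] H a}
    (hS : ∀ f, mulOp hA (S f) = f) : S.IsSymmetric ∧ ∀ f, 0 ≤ ⟪S f, f⟫_ℝ := by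
  refine ⟨fun f k => ?_, fun f => ?_⟩
  · have h1 := isSymmetric_mulOp hA (S f) (S k)
    simp only [ContinuousLinearMap.coe_coe, hS] at h1
    exact h1.symm
  · have h1 := mulOp_nonneg hA (S f)
    rwa [hS, real_inner_comm] at h1

/-- The Euler–Lagrange equation of a dual minimizer. -/
theorem inner_dual_eq_zero (ha : ∀ i, 0 < a i) (hA : IsCoefficient a A) {S : H a →ₗ[ℝ] H a}
    (hS : ∀ f, mulOp hA (S f) = f) {α : E3} {w : H a} (h : IsDualMinimizer a A α w) :
    ∀ v ∈ solenoidalSpace ha, ⟪S (constField a α + w), v⟫_ℝ = 0 := by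
  obtain ⟨hsymm, hnn⟩ := isSymmetric_and_nonneg_rightInverse hA hS
  refine inner_map_eq_zero_of_isMin hsymm hnn h.1 fun v hv => ?_
  have h1 := h.2 v hv
  rw [energy_inv_eq hA hS, energy_inv_eq hA hS] at h1
  exact le_of_mul_le_mul_left h1 (inv_pos.2 (cellVol_pos ha))

theorem isDualMinimizer_of_inner_eq_zero (ha : ∀ i, 0 < a i) (hA : IsCoefficient a A)
    {S : H a →ₗ[ℝ] H a} (hS : ∀ f, mulOp hA (S f) = f) {α : E3} {w : H a}
    (hw : w ∈ solenoidalSpace ha)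
    (h : ∀ v ∈ solenoidalSpace ha, ⟪S (constField a α + w), v⟫_ℝ = 0) :
    IsDualMinimizer a A α w := by
  obtain ⟨hsymm, hnn⟩ := isSymmetric_and_nonneg_rightInverse hA hS
  refine ⟨hw, fun v hv => ?_⟩
  rw [energy_inv_eq hA hS, energy_inv_eq hA hS]
  exact mul_le_mul_of_nonneg_left (isMin_of_inner_map_eq_zero hsymm hnn hw h v hv)
    (inv_pos.2 (cellVol_pos ha)).le

theorem inner_eq_zero_of_mem_topologicalClosure {E : Type*} [NormedAddCommGroup E]
    [InnerProductSpace ℝ E] {G : Submodule ℝ E} {x : E} (h : ∀ k ∈ G, ⟪x, k⟫_ℝ = 0) :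
    ∀ k ∈ G.topologicalClosure, ⟪x, k⟫_ℝ = 0 := by
  have h1 : G.topologicalClosure ≤ LinearMap.ker (innerSL ℝ x).toLinearMap :=
    G.topologicalClosure_minimal (fun k hk => h k hk) (innerSL ℝ x).isClosed_ker
  exact fun k hk => h1 hk

open scoped Pointwise in
/-- The infimum defining `homEnergy`, expressed through the solution `s` of the Euler–Lagrange
equation in the closure of the gradients. -/
theorem homEnergy_eq (ha : ∀ i, 0 < a i) (hA : IsCoefficient a A) {η : E3} {s : H a}
    (hs : s ∈ (gradSpace ha).topologicalClosure)
    (hel : ∀ k ∈ (gradSpace ha).topologicalClosure,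
      ⟪mulOp hA (constField a η + s), k⟫_ℝ = 0) :
    homEnergy a A η = (cellVol a)⁻¹ * ⟪mulOp hA (constField a η + s), constField a η⟫_ℝ := by
  have h1 := isGLB_energy (isSymmetric_mulOp hA) (mulOp_nonneg hA) hs hel
  have h2 : {e : ℝ | ∃ (u : L2Scalar a) (g : H a), IsPerGrad a u g ∧ e = energy a A η g}
      = (cellVol a)⁻¹ • ((fun g => ⟪mulOp hA (constField a η + g), constField a η + g⟫_ℝ) ''
        (gradSpace ha : Set (H a))) := by
    ext e
    rw [Set.mem_smul_set]
    constructor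
    · rintro ⟨u, g, hg, rfl⟩
      exact ⟨_, ⟨g, ⟨u, hg⟩, rfl⟩, (energy_eq hA η g).symm⟩
    · rintro ⟨_, ⟨g, ⟨u, hg⟩, rfl⟩, rfl⟩
      exact ⟨u, g, hg, (energy_eq hA η g).symm⟩
  rw [homEnergy, h2, Real.sInf_smul_of_nonneg (inv_pos.2 (cellVol_pos ha)).le,
    h1.csInf_eq ⟨_, 0, (gradSpace ha).zero_mem, rfl⟩, smul_eq_mul, inner_add_right, hel s hs,
    add_zero]

/-- The mean flux of a solution of the Euler–Lagrange equation is `A* ξ`. -/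
theorem integral_flux (ha : ∀ i, 0 < a i) (hA : IsCoefficient a A) {ξ : E3} {g : H a}
    (hg : g ∈ gradSpace ha)
    (hel : ∀ k ∈ gradSpace ha, ⟪mulOp hA (constField a ξ + g), k⟫_ℝ = 0) :
    ∫ x in cell a, mulOp hA (constField a ξ + g) x = cellVol a • mv (homMatrix a A) ξ := by
  have hV := cellVol_pos ha
  obtain ⟨m, M, hm, -, hb⟩ := hA.bounds
  have hex : ∀ η : E3, ∃ s ∈ (gradSpace ha).topologicalClosure,
      ∀ k ∈ (gradSpace ha).topologicalClosure,
        ⟪mulOp hA (constField a η + s), k⟫_ℝ = 0 := by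
    intro η
    obtain ⟨s, hs, h1⟩ := exists_mem_forall_inner_map_eq (mulOp hA) hm
      (fun f => (mulOp_bounds hA hb f).1) (gradSpace ha).topologicalClosure
      (gradSpace ha).isClosed_topologicalClosure (-mulOp hA (constField a η))
    refine ⟨s, hs, fun k hk => ?_⟩
    rw [map_add, inner_add_left, h1 k hk, inner_neg_left, add_neg_cancel]
  choose s hs hsel using hex
  -- `Q η` is the mean flux of the solution for `η`; it is symmetric in `η` by duality
  let Q : E3 → E3 := fun η => (cellVol a)⁻¹ • ∫ x in cell a, mulOp hA (constField a η + s η) x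
  have hQ : ∀ η ζ, ⟪Q η, ζ⟫_ℝ
      = (cellVol a)⁻¹ * ⟪mulOp hA (constField a η + s η), constField a ζ⟫_ℝ := by
    intro η ζ
    rw [real_inner_smul_left, real_inner_comm (constField a ζ), inner_constField,
      real_inner_comm]
  have hpair : ∀ (η : E3) {ζ : E3} {k : H a}, k ∈ (gradSpace ha).topologicalClosure →
      (∀ l ∈ (gradSpace ha).topologicalClosure, ⟪mulOp hA (constField a ζ + k), l⟫_ℝ = 0) →
      ⟪mulOp hA (constField a ζ + k), constField a η⟫_ℝ
        = ⟪mulOp hA (constField a η + s η), constField a ζ⟫_ℝ := by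
    intro η ζ k hk hkel
    have h1 : ⟪mulOp hA (constField a ζ + k), constField a η + s η⟫_ℝ
        = ⟪mulOp hA (constField a ζ + k), constField a η⟫_ℝ := by
      rw [inner_add_right, hkel _ (hs η), add_zero]
    have h2 : ⟪mulOp hA (constField a η + s η), constField a ζ + k⟫_ℝ
        = ⟪mulOp hA (constField a η + s η), constField a ζ⟫_ℝ := by
      rw [inner_add_right, hsel η _ hk, add_zero]
    rw [← h1, ← h2, real_inner_comm]
    exact (isSymmetric_mulOp hA _ _).symm
  have hQs : ∀ η ζ, ⟪Q η, ζ⟫_ℝ = ⟪η, Q ζ⟫_ℝ := by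
    intro η ζ
    rw [hQ, hpair ζ (hs η) (hsel η), ← hQ, real_inner_comm]
  have hQa : ∀ η ζ, Q (η + ζ) = Q η + Q ζ := by
    intro η ζ
    refine ext_inner_right ℝ fun v => ?_
    rw [hQs, inner_add_left, inner_add_left, hQs, hQs]
  have hhom : ∀ i j, homMatrix a A i j
      = ⟪Q (EuclideanSpace.single i 1), (EuclideanSpace.single j 1 : E3)⟫_ℝ := by
    intro i j
    have he : ∀ η, homEnergy a A η = ⟪Q η, η⟫_ℝ := fun η => by
      rw [hQ, homEnergy_eq ha hA (hs η) (hsel η)]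
    have h1 : ⟪Q (EuclideanSpace.single j 1), (EuclideanSpace.single i 1 : E3)⟫_ℝ
        = ⟪Q (EuclideanSpace.single i 1), (EuclideanSpace.single j 1 : E3)⟫_ℝ := by
      rw [hQs, real_inner_comm]
    simp only [homMatrix, Matrix.of_apply, he, hQa, inner_add_left, inner_add_right]
    rw [h1]
    ring
  have hmv : mv (homMatrix a A) ξ = Q ξ := by
    ext i
    have h1 : Q ξ i = ⟪Q ξ, (EuclideanSpace.single i 1 : E3)⟫_ℝ := by
      simp [EuclideanSpace.inner_single_right]
    rw [h1, hQs, mv_apply, real_inner_comm, PiLp.inner_apply]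
    refine Finset.sum_congr rfl fun j _ => ?_
    rw [hhom]
    simp [EuclideanSpace.inner_single_right, mul_comm]
  rw [hmv]
  refine ext_inner_right ℝ fun η => ?_
  rw [real_inner_smul_left, hQs, real_inner_comm, ← inner_constField, real_inner_comm,
    hpair η ((gradSpace ha).le_topologicalClosure hg)
      (inner_eq_zero_of_mem_topologicalClosure hel), real_inner_comm (Q η), hQ, ← mul_assoc,
    mul_inv_cancel₀ hV.ne', one_mul]

/-- The field `A (ξ + ∇u) - A* ξ` of a primal minimizer is the dual minimizer for `A* ξ`. -/
theorem isDualMinimizer_flux (ha : ∀ i, 0 < a i) (hA : IsCoefficient a A) {ξ : E3}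
    {u : L2Scalar a} {g : H a} (h : IsPrimalMinimizer a A ξ u g) :
    IsDualMinimizer a A (mv (homMatrix a A) ξ)
      (mulOp hA (constField a ξ + g) - constField a (mv (homMatrix a A) ξ)) := by
  obtain ⟨S, hS⟩ := exists_rightInverse hA
  have hel := inner_flux_eq_zero ha hA h
  refine isDualMinimizer_of_inner_eq_zero ha hA hS
    (sub_constField_mem_solenoidalSpace ha hel (integral_flux ha hA ⟨u, h.1⟩ hel)) fun v hv => ?_
  obtain ⟨m, M, hm, -, hb⟩ := hA.bounds
  have hinj : S (mulOp hA (constField a ξ + g)) = constField a ξ + g := by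
    rw [← sub_eq_zero, ← norm_eq_zero, ← sq_eq_zero_iff, ← real_inner_self_eq_norm_sq]
    have h1 := (mulOp_bounds hA hb (S (mulOp hA (constField a ξ + g)) - (constField a ξ + g))).1
    rw [map_sub, hS, sub_self, inner_zero_left] at h1
    exact le_antisymm (nonpos_of_mul_nonpos_right h1 hm) real_inner_self_nonneg
  rw [add_sub_cancel, hinj, inner_add_left, inner_constField, hv.2, inner_zero_right,
    inner_grad_solenoidal ha h.1 hv, add_zero]

/-- The bound `|A* ξ| ≤ λ₂(A) |ξ|`, from `‖T p‖² ≤ λ₂ ⟪T p, p⟫` at the minimizing field `p` and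
comparison of its energy with that of the constant field. -/
theorem norm_homMatrix_le (ha : ∀ i, 0 < a i) (hA : IsCoefficient a A) {ξ : E3}
    {u : L2Scalar a} {g : H a} (h : IsPrimalMinimizer a A ξ u g) :
    ‖mv (homMatrix a A) ξ‖ ≤ lam2 a A * ‖ξ‖ := by
  have hV := cellVol_pos ha
  obtain ⟨-, h2, hb⟩ := hA.lam_bounds ha
  have hub := fun f => (mulOp_bounds hA hb f).2
  have hel := inner_flux_eq_zero ha hA h
  set p := constField a ξ + g with hp
  have e1 : ‖mulOp hA p‖ ^ 2 ≤ lam2 a A * ⟪mulOp hA p, p⟫_ℝ :=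
    norm_sq_map_le (isSymmetric_mulOp hA) h2 (mulOp_nonneg hA) hub p
  have e2 : ⟪mulOp hA p, p⟫_ℝ ≤ ⟪mulOp hA (constField a ξ), constField a ξ⟫_ℝ := by
    have := isMin_of_inner_map_eq_zero (isSymmetric_mulOp hA) (mulOp_nonneg hA)
      (V := gradSpace ha) ⟨u, h.1⟩ hel 0 (zero_mem _)
    rwa [add_zero] at this
  have e3 := hub (constField a ξ)
  rw [real_inner_self_eq_norm_sq] at e3
  have e4 : ‖mulOp hA p‖ ≤ lam2 a A * ‖constField a ξ‖ := by
    refine (abs_le_of_sq_le_sq' ?_ (by positivity)).2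
    calc _ ≤ lam2 a A * (lam2 a A * ‖constField a ξ‖ ^ 2) :=
          e1.trans (mul_le_mul_of_nonneg_left (e2.trans e3) h2.le)
      _ = _ := by ring
  have e5 : cellVol a * ‖mv (homMatrix a A) ξ‖ ^ 2
      ≤ ‖mulOp hA p‖ * ‖constField a (mv (homMatrix a A) ξ)‖ := by
    refine le_trans (le_of_eq ?_) (real_inner_le_norm _ _)
    rw [real_inner_comm, inner_constField, integral_flux ha hA ⟨u, h.1⟩ hel,
      real_inner_smul_right, real_inner_self_eq_norm_sq]
  have e6 := e5.trans (mul_le_mul_of_nonneg_right e4 (norm_nonneg _))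
  rw [norm_constField, norm_constField] at e6
  have e7 : lam2 a A * (√(cellVol a) * ‖ξ‖) * (√(cellVol a) * ‖mv (homMatrix a A) ξ‖)
      = cellVol a * (lam2 a A * ‖ξ‖ * ‖mv (homMatrix a A) ξ‖) := by
    have := Real.mul_self_sqrt hV.le
    linear_combination (lam2 a A * ‖ξ‖ * ‖mv (homMatrix a A) ξ‖) * this
  rw [e7] at e6
  have e8 := le_of_mul_le_mul_left e6 hV
  rcases (norm_nonneg (mv (homMatrix a A) ξ)).eq_or_lt with h0 | h0
  · rw [← h0]; positivity
  · exact le_of_mul_le_mul_right (by rwa [sq] at e8) h0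

end Homogenization

theorem norm_mv_le_norm2 (M : Matrix (Fin 3) (Fin 3) ℝ) (v : E3) : ‖mv M v‖ ≤ norm2 M * ‖v‖ :=
  (Matrix.toEuclideanCLM (n := Fin 3) (𝕜 := ℝ) M).le_opNorm v

theorem lemma5 :
    ∃ (c₁ c₂ : ℝ → ℝ → ℝ → ℝ → ℝ → ℝ) (c : ℝ → ℝ → ℝ → ℝ → ℝ → ℝ → ℝ),
      (∀ V s t p q, 0 < c₁ V s t p q ∧ 0 < c₂ V s t p q) ∧
      (∀ V s t p q κ, 0 < c V s t p q κ) ∧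
      ∀ (a : Fin 3 → ℝ), (∀ i, 0 < a i) →
      ∀ (A : E3 → Matrix (Fin 3) (Fin 3) ℝ), IsCoefficient a A →
      ∀ (h κ : ℝ), 0 < h →
      ∀ (Wh : Submodule ℝ (H a)), FiniteDimensional ℝ Wh → (∀ v ∈ Wh, MemW0 a v) →
        HasApproxProperty a A Wh h κ →
      ∀ (ξ : E3), ‖ξ‖ = 1 →
      ∀ (u : L2Scalar a) (g : H a), IsPrimalMinimizer a A ξ u g →
      ∀ (ut : L2Scalar a) (gt : H a), IsPerGrad a ut gt →
      ∀ (δ₁ δ₂ : ℝ), ‖gt - g‖ < δ₁ →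
      ∀ (At : Matrix (Fin 3) (Fin 3) ℝ), norm2 (At - homMatrix a A) < δ₂ →
      ∀ (wt : H a), IsProjection a Wh (fieldH A At ξ gt) wt →
      ∀ (w : H a), IsDualMinimizer a A (mv At ξ) w →
        ‖wt - w‖ ≤
          c₁ (cellVol a) (lam1 a A) (lam2 a A)
              (minEig (homMatrix a A)) (maxEig (homMatrix a A)) * δ₁ +
          c₂ (cellVol a) (lam1 a A) (lam2 a A)
              (minEig (homMatrix a A)) (maxEig (homMatrix a A)) * δ₂ +
          c (cellVol a) (lam1 a A) (lam2 a A)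
              (minEig (homMatrix a A)) (maxEig (homMatrix a A)) κ * h := by
  refine ⟨fun _ _ t _ _ => |t| + 1, fun V s t _ _ => √V * (1 + |t / s|) + 1,
    fun _ _ t _ _ κ => 2 * (|κ| * |t|) + 1, fun V s t p q => ⟨by positivity, by positivity⟩,
    fun V s t p q κ => by positivity, ?_⟩
  intro a ha A hA h κ hh Wh _ _ hWh ξ hξ u g hug ut gt _ δ₁ δ₂ hδ₁ At hδ₂ wt hwt w hw
  obtain ⟨h1, h2, hb⟩ := hA.lam_bounds ha
  have hd₁ : 0 < δ₁ := (norm_nonneg _).trans_lt hδ₁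
  have hd₂ : 0 < δ₂ := (norm_nonneg _).trans_lt hδ₂
  obtain ⟨S, hS⟩ := exists_rightInverse hA
  set α₀ := mv (homMatrix a A) ξ with hα₀
  set α := mv At ξ with hα
  -- the exact dual minimizer for `A* ξ`, and the perturbed flux as an element of `H`
  set w₀ := mulOp hA (constField a ξ + g) - constField a α₀ with hw₀
  set wH := mulOp hA (constField a ξ + gt) - constField a α with hwH
  have hdual : IsDualMinimizer a A α₀ w₀ := isDualMinimizer_flux ha hA hug
  have hα_le : ‖constField a α - constField a α₀‖ ≤ √(cellVol a) * δ₂ := by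
    rw [← map_sub, norm_constField]
    refine mul_le_mul_of_nonneg_left ?_ (Real.sqrt_nonneg _)
    have h3 : α - α₀ = mv (At - homMatrix a A) ξ := by simp [hα, hα₀, mv]
    rw [h3]
    have h4 := norm_mv_le_norm2 (At - homMatrix a A) ξ
    rw [hξ, mul_one] at h4
    exact h4.trans hδ₂.le
  have hproj : ∀ v ∈ Wh, ⟪wt, v⟫_ℝ = ⟪wH, v⟫_ℝ := by
    intro v hv
    rw [hwt.2 v hv, L2.inner_def]
    refine integral_congr_ae ?_
    filter_upwards [Lp.coeFn_sub (mulOp hA (constField a ξ + gt)) (constField a α),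
      coeFn_mulOp hA (constField a ξ + gt), coeFn_constField (a := a) α,
      Lp.coeFn_add (constField a ξ) gt, coeFn_constField (a := a) ξ] with x e1 e2 e3 e4 e5
    rw [e1, Pi.sub_apply, e2, e3, e4, Pi.add_apply, e5]
    rfl
  have b1 := norm_sub_le_of_projection hwt.1 hproj w₀
  have b2 : ‖wH - w₀‖ ≤ lam2 a A * δ₁ + √(cellVol a) * δ₂ := by
    have h3 : wH - w₀ = mulOp hA (gt - g) - (constField a α - constField a α₀) := by
      simp only [hwH, hw₀, map_add, map_sub]
      abel
    rw [h3]
    refine (norm_sub_le _ _).trans (add_le_add ?_ hα_le)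
    refine (norm_map_le (isSymmetric_mulOp hA) h2 (mulOp_nonneg hA)
      (fun f => (mulOp_bounds hA hb f).2) _).trans ?_
    exact mul_le_mul_of_nonneg_left hδ₁.le h2.le
  have b3 : Metric.infDist w₀ (Wh : Set (H a)) ≤ |κ| * |lam2 a A| * h := by
    have h3 := norm_homMatrix_le ha hA hug
    rw [hξ, mul_one] at h3
    calc _ ≤ κ * h * ‖α₀‖ := hWh α₀ w₀ hdual
      _ ≤ |κ| * h * |lam2 a A| := by
        gcongr
        · exact le_abs_self _
        · exact h3.trans (le_abs_self _)
      _ = _ := by ring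
  have b4 : ‖w₀ - w‖ ≤ |lam2 a A / lam1 a A| * (√(cellVol a) * δ₂) := by
    have h3 := norm_sub_le_of_dual (T := (mulOp hA : H a →ₗ[ℝ] H a)) (isSymmetric_mulOp hA) h1 h2
      (fun f => (mulOp_bounds hA hb f).1) (fun f => (mulOp_bounds hA hb f).2) hS
      (W := solenoidalSpace ha) hdual.1 hw.1 (inner_dual_eq_zero ha hA hS hdual)
      (inner_dual_eq_zero ha hA hS hw)
    refine h3.trans ?_
    rw [norm_sub_rev]
    gcongr
    exact le_abs_self _
  have b5 : ‖wt - w‖ ≤ ‖wt - w₀‖ + ‖w₀ - w‖ := norm_sub_le_norm_sub_add_norm_sub _ _ _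
  have b6 : lam2 a A * δ₁ ≤ |lam2 a A| * δ₁ :=
    mul_le_mul_of_nonneg_right (le_abs_self _) hd₁.le
  dsimp only
  linarith
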